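/- **Setting.** Let $V$ be a finite set, and let $T$ be a finite set of tiles. A tile $t$ is a finite multiset of elements of $V$; write $t_v$ for the multiplicity of $v$ in $t$. All tiles have the same size $\sum_v t_v=\delta\ge 1$. Let $w_t>0$ ($t\in T$) be weights. For $\mathbf N\in\mathbb Z_{\ge0}^V$, put $N_v$ points above each $v\in V$. An $\mathbf N$-fold tiling is a partition of all these points into lifts of tiles, where a lift of $t$ is a set consisting of exactly $t_v$ points above $v$, for each $v$. A tiling in which $X_t$ blocks are lifts of $t$ ($t\in T$) has probability proportional to $\prod_t w_t^{X_t}$. Let $D:\mathbb R^T\to\mathbb R^V$ be the matrix $D_{v,t}=t_v$, with transpose $D^*$. For $\beta\in\mathbb R^V$, *critical-gauge weights* for $\beta$ are numbers of the form $w'_t=w_t\prod_v \frac{x_v^{t_v}}{t_v!}$, with all $x_v>0$, such that $\sum_t w'_t t_v=\beta_v$ for every $v$. **Theorem 5.1.** Let $\alpha\in D(\mathbb R_{>0}^T)$. Let $\mathbf N=\mathbf N^{(k)}\in D(\mathbb Z_{\ge0}^T)$ and $K=K^{(k)}$ be sequences with $\sum_v N_v=\delta K$ (so that $K$ is the number of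 tiles), $K\to\infty$ and $N_v/K\to\alpha_v$ for each $v$. Then tilings exist for every $k$, there are unique critical-gauge weights $\bar w$ for $\alpha$, and the following hold. Put $C=\operatorname{diag}(\bar w_t)$ and $\Delta=DCD^*$ (the tiling laplacian for the weights $\bar w$), and let $\mathbb K=D^*\Delta^{-1}D$, where $\Delta^{-1}$ is the inverse of $\Delta$ as an operator on $\operatorname{Im}D$. Let $\Sigma_{s,t}=\bar w_s\,(I-C\mathbb K)_{t,s}$. 1. $\mathbb E[X_t]/K\to \bar w_t$ and $\operatorname{Cov}(X_s,X_t)/K\to\Sigma_{s,t}$ for all $s,t\in T$. 2. $I-C\mathbb K$ is the projection with kernel $C\operatorname{Im}(D^*)$ and image $\ker D$, and $\Sigma$ is positive semidefinite. 3. For all large $k$ there are unique critical-gauge weights $w^{(k)}$ for the vector $(N_v/K)_v$. One has $w^{(k)}\to\bar w$ and $(\mathbb E[X_t]-Kw^{(k)}_t)/\sqrt K\to0$ for each $t$, and $(X-Kw^{(k)})/\sqrt K$ converges in distribution to the centred Gaussian on $\mathbb R^T$ with covariance matrix $\Sigma$. 4. If moreover $(N_v-K\alpha_v)/\sqrt K\to0$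 for each $v$ (for example if $N_v=K\alpha_v$), then $(\mathbb E[X_t]-K\bar w_t)/\sqrt K\to0$ for each $t$, and $(X-K\bar w)/\sqrt K$ converges in distribution to the centred Gaussian on $\mathbb R^T$ with covariance matrix $\Sigma$. -/

import Mathlib

open MeasureTheory ProbabilityTheory Filter Topology

noncomputable section

namespace MultinomialTiling

/- A tile is a finite multiset of vertices: `t.count v` is the multiplicity `t_v` of `v` in `t`.
A tile set is a finite set `T` of tiles. As a subgraph, a tile carries all the edges joining its
vertices, so that edges play no role below. -/
variable {V : Type*} [Fintype V] [DecidableEq V]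

/-- The vertices of the `N`-fold blowup: `N v` vertices lie above each vertex `v`. -/
abbrev BlowupVertex (N : V → ℕ) : Type _ := Σ v : V, Fin (N v)

/-- The multiset of base vertices that lie below a set of vertices of the blowup. -/
def shadow {N : V → ℕ} (s : Finset (BlowupVertex N)) : Multiset V := s.val.map Sigma.fst

/-- `s` is a lift of the tile `t`: it consists of `t_v` distinct vertices above `v`, for each `v`. -/
def IsLift {N : V → ℕ} (t : Multiset V) (s : Finset (BlowupVertex N)) : Prop := shadow s = t

instance {N : V → ℕ} (t : Multiset V) (s : Finset (BlowupVertex N)) : Decidable (IsLift t s) :=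
  inferInstanceAs (Decidable (shadow s = t))

/-- The `N`-fold tilings: partitions of the vertices of the blowup into lifts of tiles of `T`. -/
def Tiling (T : Finset (Multiset V)) (N : V → ℕ) : Type _ :=
  {P : Finpartition (Finset.univ : Finset (BlowupVertex N)) // ∀ s ∈ P.parts, ∃ t ∈ T, IsLift t s}

instance (T : Finset (Multiset V)) (N : V → ℕ) : Fintype (Tiling T N) :=
  inferInstanceAs (Fintype {P : Finpartition (Finset.univ : Finset (BlowupVertex N)) //
    ∀ s ∈ P.parts, ∃ t ∈ T, IsLift t s})

/-- Every set of tilings is an event. -/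
instance (T : Finset (Multiset V)) (N : V → ℕ) : MeasurableSpace (Tiling T N) := ⊤

/-- The number `X_t` of lifts of the tile `t` in the tiling `m`. -/
def tileCount {T : Finset (Multiset V)} {N : V → ℕ} (m : Tiling T N) (t : T) : ℕ :=
  (m.1.parts.filter (fun s => IsLift t.1 s)).card

/-- The weight `∏_t w_t ^ X_t` of a tiling. -/
def tilingWeight {T : Finset (Multiset V)} {N : V → ℕ} (w : T → ℝ) (m : Tiling T N) : ℝ :=
  ∏ t : T, w t ^ tileCount m t

/-- The partition function. -/
def partitionFunction (T : Finset (Multiset V)) (w : T → ℝ) (N : V → ℕ) : ℝ :=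
  ∑ m : Tiling T N, tilingWeight w m

/-- The multinomial tiling measure: each tiling has probability proportional to its weight. -/
def tilingMeasure (T : Finset (Multiset V)) (w : T → ℝ) (N : V → ℕ) : Measure (Tiling T N) :=
  ∑ m : Tiling T N,
    ENNReal.ofReal (tilingWeight w m / partitionFunction T w N) • Measure.dirac m

/-- `N` is a feasible multiplicity: a nonnegative integer combination of the tiles. -/
def IsFeasible (T : Finset (Multiset V)) (N : V → ℕ) : Prop :=
  ∃ c : T → ℕ, ∀ v, N v = ∑ t : T, c t * t.1.count v

/-- `α` lies in the cone of real feasible multiplicities: it is a combination of the tiles with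
positive real coefficients. -/
def InFeasibleCone (T : Finset (Multiset V)) (α : V → ℝ) : Prop :=
  ∃ c : T → ℝ, (∀ t, 0 < c t) ∧ ∀ v, α v = ∑ t : T, c t * (t.1.count v : ℝ)

/-- The tile monomial `x_t = ∏_v x_v ^ t_v / t_v!`. -/
def tileMonomial (x : V → ℝ) (t : Multiset V) : ℝ :=
  ∏ v, x v ^ t.count v / (Nat.factorial (t.count v) : ℝ)

/-- `w'` are critical-gauge weights of `w` for `α`: they are `w'_t = w_t x_t` for a positive
function `x` on the vertices, and for each vertex `v` the weights `w'_t` of the tiles that contain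
`v`, counted with multiplicity, sum to `α v`. -/
def IsCriticalGauge (T : Finset (Multiset V)) (w : T → ℝ) (α : V → ℝ) (w' : T → ℝ) : Prop :=
  (∃ x : V → ℝ, (∀ v, 0 < x v) ∧ ∀ t : T, w' t = w t * tileMonomial x t.1) ∧
    ∀ v, ∑ t : T, w' t * (t.1.count v : ℝ) = α v

/-- The incidence matrix `D`, with entries `D_{v,t} = t_v`. -/
def incidence (T : Finset (Multiset V)) : Matrix V T ℝ := Matrix.of fun v t => (t.1.count v : ℝ)

/-- The tiling laplacian `Δ = D C D*`, where `C` is the diagonal matrix of the weights. -/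
def laplacian (T : Finset (Multiset V)) (w : T → ℝ) : Matrix V V ℝ :=
  incidence T * Matrix.diagonal w * (incidence T).transpose

/-- The image of `D`. -/
abbrev imD (T : Finset (Multiset V)) : Submodule ℝ (V → ℝ) :=
  LinearMap.range (incidence T).mulVecLin

theorem laplacian_mem_imD (T : Finset (Multiset V)) (w : T → ℝ) (u : V → ℝ) :
    (laplacian T w).mulVecLin u ∈ imD T := by
  refine ⟨(Matrix.diagonal w * (incidence T).transpose).mulVec u, ?_⟩
  rw [Matrix.mulVecLin_apply, Matrix.mulVecLin_apply, laplacian, Matrix.mulVec_mulVec,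
    Matrix.mul_assoc]

/-- The laplacian as an operator from the image of `D` to itself. -/
def laplacianOnImage (T : Finset (Multiset V)) (w : T → ℝ) : Module.End ℝ (imD T) :=
  (laplacian T w).mulVecLin.restrict (fun u _ => laplacian_mem_imD T w u)

/-- For positive weights the laplacian is invertible on the image of `D`, so that the
`Ring.inverse` in the next definition is its true inverse. -/
theorem isUnit_laplacianOnImage (T : Finset (Multiset V)) (w : T → ℝ) (hw : ∀ t, 0 < w t) :
    IsUnit (laplacianOnImage T w) := by
  rw [LinearMap.isUnit_iff_ker_eq_bot, LinearMap.ker_eq_bot']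
  rintro ⟨u, x, hx⟩ hu
  have h0 : (laplacian T w).mulVec u = 0 := congrArg Subtype.val hu
  set y : T → ℝ := (incidence T).transpose.mulVec u with hy
  have h1 : ∑ t, w t * (y t * y t) = 0 := by
    have h2 : u ⬝ᵥ (laplacian T w).mulVec u = 0 := by rw [h0, dotProduct_zero]
    rw [laplacian, Matrix.mul_assoc, ← Matrix.mulVec_mulVec, Matrix.dotProduct_mulVec,
      ← Matrix.mulVec_transpose, ← Matrix.mulVec_mulVec, ← hy] at h2
    rw [← h2]
    refine Finset.sum_congr rfl fun t _ => ?_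
    rw [Matrix.mulVec_diagonal]
    ring
  have h3 : y = 0 := by
    funext t
    have h4 := (Finset.sum_eq_zero_iff_of_nonneg
      (fun t _ => mul_nonneg (hw t).le (mul_self_nonneg (y t)))).1 h1 t (Finset.mem_univ t)
    exact mul_self_eq_zero.1 ((mul_eq_zero.1 h4).resolve_left (hw t).ne')
  have h5 : u ⬝ᵥ u = 0 := by
    have hx' : (incidence T).mulVec x = u := hx
    calc u ⬝ᵥ u = u ⬝ᵥ (incidence T).mulVec x := by rw [hx']
      _ = y ⬝ᵥ x := by rw [Matrix.dotProduct_mulVec, ← Matrix.mulVec_transpose, hy]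
      _ = 0 := by rw [h3, zero_dotProduct]
  exact Subtype.ext (dotProduct_self_eq_zero.1 h5)

/-- The matrix `𝕂 = D* Δ⁻¹ D`, where `Δ⁻¹` is the inverse of the laplacian on the image of `D`. -/
def kernelMatrix (T : Finset (Multiset V)) (w : T → ℝ) : Matrix T T ℝ :=
  LinearMap.toMatrix' ((incidence T).transpose.mulVecLin ∘ₗ (imD T).subtype ∘ₗ
    Ring.inverse (laplacianOnImage T w) ∘ₗ (incidence T).mulVecLin.rangeRestrict)

/-- The matrix `I - C 𝕂`. -/
def complProjection (T : Finset (Multiset V)) (w : T → ℝ) : Matrix T T ℝ :=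
  1 - Matrix.diagonal w * kernelMatrix T w

/-- The matrix with entries `w_s (I - C 𝕂)_{t,s}`. -/
def covMatrix (T : Finset (Multiset V)) (w : T → ℝ) : Matrix T T ℝ :=
  Matrix.of fun s t => w s * complProjection T w t s

/-- The random vector `(X - K c) / √K`. -/
def fluctuation {T : Finset (Multiset V)} {N : V → ℕ} (K : ℕ) (c : T → ℝ) (m : Tiling T N) :
    EuclideanSpace ℝ T :=
  WithLp.toLp 2 fun t => ((tileCount m t : ℝ) - K * c t) / √(K : ℝ)

end MultinomialTiling

end

open MultinomialTiling

/-!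
The number of tilings with tile counts `c` is a multinomial coefficient: it is zero unless
`D c = N`, and then it equals `∏ v, N_v! / ∏ t, (c_t! * (∏ v, t_v!) ^ c_t)` (`card_tilingsWith`,
by removing one tile at a time). Hence `X` has the law of independent Poisson variables conditioned
on `D X = N`, and because of the conditioning the means of these variables may be changed by any
gauge (`integral_tileCount`). With critical-gauge weights `w` for `N / K` the means are `K w`, and
`D (K w) = N`: the centre of the Poisson variables lies in the affine space on which `X` is
supported.

Critical-gauge weights are the gradient condition of a convex minimisation problem, which gives
existence (`exists_isCriticalGauge`) and uniqueness (`IsCriticalGauge.unique`). The linearisation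
of the problem at a solution is the tiling laplacian, so by the inverse function theorem the
weights are Lipschitz functions of `N / K` near `α` (`exists_local_criticalGauge`).

By Stirling's formula, the Poisson probabilities at `K w + √K z` are asymptotically proportional to
`exp (-∑ t, z_t ^ 2 / (2 w_t))`, with exponential bounds that are uniform in `K`
(`tendsto_poissonDensity`, `poissonDensity_le`). The integer points of `D X = N` form a translate of
a lattice in `ker D`, so that expectations are quotients of Riemann sums with mesh `1 / √K`. These
converge by dominated convergence (`tendsto_lattice_sum`, `exists_tendsto_sum_poissonWeight`) to
integrals over `ker D` with respect to the Gaussian measure with this density, and the covariance of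
that measure is `w_s (I - C 𝕂)_{t,s}`, because `I - C 𝕂` is the projection to `ker D` that is
orthogonal for the form `∑ t, z_t ^ 2 / w_t` (`map_stdGaussian_fluctSpace`). Quadratic test
functions give the means and covariances, bounded ones the convergence in distribution.
-/

namespace MultinomialTiling

noncomputable section

/-! ### Counting tilings with prescribed tile counts -/

section Counting

variable {V : Type*} [DecidableEq V]

theorem ne_zero_of_card_eq {V : Type*} {T : Finset (Multiset V)} {δ : ℕ} (hδ : 0 < δ)
    (hsize : ∀ t ∈ T, Multiset.card t = δ) : ∀ t ∈ T, t ≠ 0 := by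
  rintro t ht rfl
  exact hδ.ne (hsize 0 ht)

/-- The number of points of `S` above `v`. -/
def fiberCard {N : V → ℕ} (S : Finset (BlowupVertex N)) (v : V) : ℕ :=
  (S.filter fun p => p.1 = v).card

theorem count_shadow {N : V → ℕ} (S : Finset (BlowupVertex N)) (v : V) :
    (shadow S).count v = fiberCard S v := by
  rw [shadow, Multiset.count_map, fiberCard, Finset.card_def, Finset.filter_val]
  simp only [eq_comm]

theorem isLift_iff {N : V → ℕ} (t : Multiset V) (s : Finset (BlowupVertex N)) :
    IsLift t s ↔ ∀ v, fiberCard s v = t.count v := by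
  simp only [IsLift, Multiset.ext, count_shadow]

theorem fiberCard_sdiff {N : V → ℕ} {s S : Finset (BlowupVertex N)} (h : s ⊆ S) (v : V) :
    fiberCard (S \ s) v + fiberCard s v = fiberCard S v := by
  have h1 : (S \ s).filter (fun p => p.1 = v)
      = S.filter (fun p => p.1 = v) \ s.filter (fun p => p.1 = v) := by
    ext p; simp only [Finset.mem_filter, Finset.mem_sdiff]; tauto
  rw [fiberCard, h1]
  exact Finset.card_sdiff_add_card_eq_card (Finset.filter_subset_filter _ h)

variable [Fintype V]

theorem fiberCard_univ (N : V → ℕ) (v : V) :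
    fiberCard (Finset.univ : Finset (BlowupVertex N)) v = N v := by
  have h : (Finset.univ.filter fun p : BlowupVertex N => p.1 = v)
      = (Finset.univ : Finset (Fin (N v))).map (Function.Embedding.sigmaMk v) := by
    ext ⟨u, i⟩
    simp only [Finset.mem_filter, Finset.mem_univ, true_and, Finset.mem_map,
      Function.Embedding.sigmaMk_apply]
    constructor
    · rintro rfl
      exact ⟨i, rfl⟩
    · rintro ⟨j, hj⟩
      exact (congrArg Sigma.fst hj).symm
  rw [fiberCard, h, Finset.card_map, Finset.card_univ, Fintype.card_fin]

/-- The lifts of `t` inside `S` are chosen fibre by fibre. -/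
theorem card_lifts {N : V → ℕ} (S : Finset (BlowupVertex N)) (t : Multiset V) :
    (S.powerset.filter (IsLift t)).card = ∏ v, (fiberCard S v).choose (t.count v) := by
  have h : ∏ v, (fiberCard S v).choose (t.count v) = (Fintype.piFinset fun v =>
      Finset.powersetCard (t.count v) (S.filter fun p => p.1 = v)).card := by
    rw [Fintype.card_piFinset]
    simp only [Finset.card_powersetCard, fiberCard]
  rw [h]
  refine Finset.card_bij' (fun s _ v => s.filter fun p => p.1 = v)
    (fun f _ => Finset.univ.biUnion f) ?_ ?_ ?_ ?_
  · intro s hs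
    rw [Finset.mem_filter, Finset.mem_powerset, isLift_iff] at hs
    rw [Fintype.mem_piFinset]
    intro v
    exact Finset.mem_powersetCard.2 ⟨Finset.filter_subset_filter _ hs.1, hs.2 v⟩
  · intro f hf
    simp only [Fintype.mem_piFinset, Finset.mem_powersetCard] at hf
    rw [Finset.mem_filter, Finset.mem_powerset, isLift_iff]
    refine ⟨fun p hp => ?_, fun v => ?_⟩
    · obtain ⟨v, -, hv⟩ := Finset.mem_biUnion.1 hp
      exact (Finset.mem_filter.1 ((hf v).1 hv)).1
    · rw [← (hf v).2, fiberCard]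
      congr 1
      ext p
      simp only [Finset.mem_filter, Finset.mem_biUnion, Finset.mem_univ, true_and]
      constructor
      · rintro ⟨⟨u, hu⟩, rfl⟩
        rwa [← (Finset.mem_filter.1 ((hf u).1 hu)).2] at hu
      · intro hp
        exact ⟨⟨v, hp⟩, (Finset.mem_filter.1 ((hf v).1 hp)).2⟩
  · intro s _
    ext p
    simp
  · intro f hf
    simp only [Fintype.mem_piFinset, Finset.mem_powersetCard] at hf
    ext v p
    simp only [Finset.mem_filter, Finset.mem_biUnion, Finset.mem_univ, true_and]
    constructor
    · rintro ⟨⟨u, hu⟩, rfl⟩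
      rwa [← (Finset.mem_filter.1 ((hf u).1 hu)).2] at hu
    · intro hp
      exact ⟨⟨v, hp⟩, (Finset.mem_filter.1 ((hf v).1 hp)).2⟩

variable {T : Finset (Multiset V)}

open Classical in
/-- The tilings of a set `S` of points of the blowup that use exactly `c t` lifts of each tile `t`.
A tiling is encoded by the set of its blocks. -/
def tilingsWith (T : Finset (Multiset V)) {N : V → ℕ} (S : Finset (BlowupVertex N)) (c : T → ℕ) :
    Finset (Finset (Finset (BlowupVertex N))) :=
  Finset.univ.filter fun F => (∀ s ∈ F, ∃ t ∈ T, IsLift t s) ∧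
    (F : Set (Finset (BlowupVertex N))).PairwiseDisjoint id ∧ F.sup id = S ∧
    ∀ t : T, (F.filter (IsLift t.1)).card = c t

theorem mem_tilingsWith {N : V → ℕ} {S : Finset (BlowupVertex N)} {c : T → ℕ}
    {F : Finset (Finset (BlowupVertex N))} :
    F ∈ tilingsWith T S c ↔ (∀ s ∈ F, ∃ t ∈ T, IsLift t s) ∧
    (F : Set (Finset (BlowupVertex N))).PairwiseDisjoint id ∧ F.sup id = S ∧
    ∀ t : T, (F.filter (IsLift t.1)).card = c t := by
  simp [tilingsWith]

/-- Removing one lift of `t` from a tiling: pairs of a tiling and one of its lifts of `t`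
correspond to pairs of a lift of `t` and a tiling of its complement. -/
theorem succ_mul_card_tilingsWith (hT : ∀ t ∈ T, t ≠ 0) {N : V → ℕ}
    (S : Finset (BlowupVertex N)) (c : T → ℕ) (t : T) :
    (c t + 1) * (tilingsWith T S (c + Pi.single t 1)).card
      = ∑ s ∈ S.powerset.filter (IsLift t.1), (tilingsWith T (S \ s) c).card := by
  classical
  have hL : (c t + 1) * (tilingsWith T S (c + Pi.single t 1)).card
      = ((tilingsWith T S (c + Pi.single t 1)).sigma fun F => F.filter (IsLift t.1)).card := by
    rw [Finset.card_sigma, Finset.sum_congr rfl (fun F hF => (mem_tilingsWith.1 hF).2.2.2 t)]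
    simp [mul_comm]
  rw [hL, ← Finset.card_sigma]
  have key : ∀ (s : Finset (BlowupVertex N)) (u : T), IsLift t.1 s →
      (IsLift u.1 s ↔ u = t) := by
    intro s u hs
    constructor
    · intro hu
      exact Subtype.ext (hu.symm.trans hs)
    · rintro rfl
      exact hs
  -- a lift of `t` is nonempty, hence it is not a block of a tiling of its complement
  have hnot : ∀ (s : Finset (BlowupVertex N)) (F : Finset (Finset (BlowupVertex N))),
      IsLift t.1 s → F.sup id = S \ s → s ∉ F := by
    intro s F hst h3 hs
    have hsub : s ⊆ S \ s := h3 ▸ Finset.le_sup (f := id) hs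
    have h5 : s = ∅ := Finset.disjoint_self_iff_empty s |>.1
      (Finset.disjoint_left.2 fun p hp _ => (Finset.mem_sdiff.1 (hsub hp)).2 hp)
    refine hT t.1 t.2 ?_
    rw [← hst, h5]
    rfl
  refine Finset.card_bij' (fun x _ => ⟨x.2, x.1.erase x.2⟩) (fun y _ => ⟨insert y.1 y.2, y.1⟩)
    ?_ ?_ ?_ ?_
  · rintro ⟨F, s⟩ h
    simp only [Finset.mem_sigma, Finset.mem_filter, mem_tilingsWith] at h
    obtain ⟨⟨h1, h2, h3, h4⟩, hs, hst⟩ := h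
    simp only [Finset.mem_sigma, Finset.mem_filter, mem_tilingsWith, Finset.mem_powerset]
    refine ⟨⟨h3 ▸ Finset.le_sup (f := id) hs, hst⟩,
      fun u hu => h1 u (Finset.mem_of_mem_erase hu), h2.subset (by simp), ?_, fun u => ?_⟩
    · ext p
      rw [← h3]
      simp only [Finset.mem_sup, Finset.mem_erase, id, Finset.mem_sdiff]
      constructor
      · rintro ⟨u, ⟨hne, hu⟩, hp⟩
        exact ⟨⟨u, hu, hp⟩, fun hps => Finset.disjoint_left.1 (h2 hu hs hne) hp hps⟩
      · rintro ⟨⟨u, hu, hp⟩, hps⟩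
        exact ⟨u, ⟨fun h => hps (h ▸ hp), hu⟩, hp⟩
    · have h5 := h4 u
      rw [Finset.filter_erase]
      by_cases hut : u = t
      · subst hut
        rw [Finset.card_erase_of_mem (Finset.mem_filter.2 ⟨hs, hst⟩), h5]
        simp
      · rw [Finset.erase_eq_of_notMem (fun h => hut ((key s u hst).1 (Finset.mem_filter.1 h).2)),
          h5]
        simp [hut]
  · rintro ⟨s, F⟩ h
    simp only [Finset.mem_sigma, Finset.mem_filter, mem_tilingsWith, Finset.mem_powerset] at h
    obtain ⟨⟨hsS, hst⟩, h1, h2, h3, h4⟩ := h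
    have hsub : ∀ u ∈ F, u ⊆ S \ s := fun u hu => h3 ▸ Finset.le_sup (f := id) hu
    have hsF := hnot s F hst h3
    simp only [Finset.mem_sigma, Finset.mem_filter, mem_tilingsWith]
    refine ⟨⟨?_, ?_, ?_, fun u => ?_⟩, Finset.mem_insert_self _ _, hst⟩
    · intro u hu
      rcases Finset.mem_insert.1 hu with rfl | hu
      · exact ⟨t.1, t.2, hst⟩
      · exact h1 u hu
    · rw [Finset.coe_insert]
      refine h2.insert fun u hu _ => ?_
      exact Finset.disjoint_left.2 fun p hp hpu => (Finset.mem_sdiff.1 (hsub u hu hpu)).2 hp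
    · rw [Finset.sup_insert, h3]
      simp [hsS]
    · rw [Finset.filter_insert]
      by_cases hut : u = t
      · subst hut
        rw [if_pos hst, Finset.card_insert_of_notMem (by simp [hsF]), h4]
        simp
      · rw [if_neg (fun h => hut ((key s u hst).1 h)), h4]
        simp [hut]
  · rintro ⟨F, s⟩ h
    simp only [Finset.mem_sigma, Finset.mem_filter] at h
    simp [Finset.insert_erase h.2.1]
  · rintro ⟨s, F⟩ h
    simp only [Finset.mem_sigma, Finset.mem_filter, mem_tilingsWith, Finset.mem_powerset] at h
    obtain ⟨⟨hsS, hst⟩, h1, h2, h3, h4⟩ := h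
    have hsF := hnot s F hst h3
    simp [Finset.erase_insert hsF]

/-- The number of tilings with prescribed tile counts is a multinomial coefficient. -/
theorem card_tilingsWith (hT : ∀ t ∈ T, t ≠ 0) {N : V → ℕ} (n : ℕ) :
    ∀ (c : T → ℕ), ∑ t, c t = n → ∀ S : Finset (BlowupVertex N),
    (tilingsWith T S c).card * ∏ t : T, ((c t).factorial *
        (∏ v, (t.1.count v).factorial) ^ c t)
      = if ∀ v, fiberCard S v = ∑ t : T, c t * t.1.count v
        then ∏ v, (fiberCard S v).factorial else 0 := by
  classical
  induction n with
  | zero =>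
    intro c hc S
    have hc0 : c = 0 := by
      funext t
      exact (Finset.sum_eq_zero_iff.1 hc) t (Finset.mem_univ t)
    subst hc0
    have hempty : ∀ F ∈ tilingsWith T S 0, F = ∅ := by
      intro F hF
      obtain ⟨h1, h2, h3, h4⟩ := mem_tilingsWith.1 hF
      refine Finset.eq_empty_of_forall_notMem fun s hs => ?_
      obtain ⟨t, ht, hst⟩ := h1 s hs
      have h5 := Finset.card_eq_zero.1 (h4 ⟨t, ht⟩)
      exact Finset.notMem_empty s (h5 ▸ Finset.mem_filter.2 ⟨hs, hst⟩)
    by_cases hS : S = ∅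
    · subst hS
      have h : tilingsWith T (∅ : Finset (BlowupVertex N)) 0 = {∅} := by
        refine Finset.eq_singleton_iff_unique_mem.2 ⟨?_, hempty⟩
        rw [mem_tilingsWith]
        simp
      rw [h]
      simp [fiberCard]
    · have h : tilingsWith T S 0 = ∅ := by
        refine Finset.eq_empty_of_forall_notMem fun F hF => hS ?_
        have h3 := (mem_tilingsWith.1 hF).2.2.1
        rw [hempty F hF] at h3
        simpa using h3.symm
      obtain ⟨p, hp⟩ := Finset.nonempty_iff_ne_empty.2 hS
      rw [h, if_neg]
      · simp
      · intro h0
        have h1 := h0 p.1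
        simp only [Pi.zero_apply, zero_mul, Finset.sum_const_zero, fiberCard,
          Finset.card_eq_zero] at h1
        exact Finset.notMem_empty p (h1 ▸ Finset.mem_filter.2 ⟨hp, rfl⟩)
  | succ n ih =>
    intro c hc S
    obtain ⟨t, ht⟩ : ∃ t, c t ≠ 0 := by
      by_contra! h
      simp [h] at hc
    obtain ⟨c', hcc'⟩ : ∃ c' : T → ℕ, c = c' + Pi.single t 1 := by
      refine ⟨Function.update c t (c t - 1), ?_⟩
      funext u
      by_cases hu : u = t
      · subst hu
        simp
        omega
      · simp [hu]
    have hc' : ∑ u, c' u = n := by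
      have : ∑ u, c u = ∑ u, c' u + 1 := by
        simp [hcc', Finset.sum_add_distrib]
      omega
    have hsum : ∀ v, ∑ u : T, c u * u.1.count v
        = ∑ u : T, c' u * u.1.count v + t.1.count v := by
      intro v
      simp [hcc', add_mul, Finset.sum_add_distrib, Pi.single_apply]
    have hprod : ∏ u : T, ((c u).factorial *
          (∏ v, (u.1.count v).factorial) ^ c u)
        = (c' t + 1) * (∏ v, (t.1.count v).factorial) * ∏ u : T, ((c' u).factorial *
          (∏ v, (u.1.count v).factorial) ^ c' u) := by
      rw [← Finset.mul_prod_erase _ _ (Finset.mem_univ t),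
        ← Finset.mul_prod_erase Finset.univ (fun u : T => (c' u).factorial * _)
          (Finset.mem_univ t)]
      rw [Finset.prod_congr rfl (g := fun u : T => (c' u).factorial *
          (∏ v, (u.1.count v).factorial) ^ c' u) (fun u hu => by
            have := Finset.ne_of_mem_erase hu
            simp [hcc', this])]
      simp only [hcc', Pi.add_apply, Pi.single_eq_same, Nat.factorial_succ, pow_succ]
      ring
    have h1 : (tilingsWith T S c).card * ∏ u : T,
          ((c u).factorial *
          (∏ v, (u.1.count v).factorial) ^ c u)
        = ∑ s ∈ S.powerset.filter (IsLift t.1), ((tilingsWith T (S \ s) c').card *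
          ∏ u : T, ((c' u).factorial * (∏ v, (u.1.count v).factorial) ^ c' u)) *
          ∏ v, (t.1.count v).factorial := by
      rw [hprod, ← Finset.sum_mul, ← Finset.sum_mul, ← succ_mul_card_tilingsWith hT, ← hcc']
      ring
    rw [h1]
    have h2 : ∀ s ∈ S.powerset.filter (IsLift t.1), ∀ v,
        fiberCard (S \ s) v + t.1.count v = fiberCard S v := by
      intro s hs v
      obtain ⟨hs1, hs2⟩ := Finset.mem_filter.1 hs
      rw [← (isLift_iff _ _).1 hs2 v]
      exact fiberCard_sdiff (Finset.mem_powerset.1 hs1) v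
    by_cases hcond : ∀ v, fiberCard S v = ∑ u : T, c u * u.1.count v
    · rw [if_pos hcond]
      have h3 : ∀ s ∈ S.powerset.filter (IsLift t.1), ((tilingsWith T (S \ s) c').card *
          ∏ u : T, ((c' u).factorial * (∏ v, (u.1.count v).factorial) ^ c' u)) *
          ∏ v, (t.1.count v).factorial
          = ∏ v, ((fiberCard S v - t.1.count v).factorial * (t.1.count v).factorial) := by
        intro s hs
        rw [ih c' hc', if_pos, Finset.prod_mul_distrib]
        · congr 1
          refine Finset.prod_congr rfl fun v _ => ?_
          rw [← h2 s hs v, Nat.add_sub_cancel]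
        · intro v
          have := h2 s hs v
          have := hcond v
          have := hsum v
          omega
      rw [Finset.sum_congr rfl h3, Finset.sum_const, card_lifts, smul_eq_mul,
        ← Finset.prod_mul_distrib]
      refine Finset.prod_congr rfl fun v _ => ?_
      have hle : t.1.count v ≤ fiberCard S v := by
        have := hcond v
        have := hsum v
        omega
      rw [← Nat.choose_mul_factorial_mul_factorial hle]
      ring
    · rw [if_neg hcond]
      refine Finset.sum_eq_zero fun s hs => ?_
      rw [ih c' hc', if_neg, zero_mul]
      intro h
      refine hcond fun v => ?_
      rw [hsum, ← h v, h2 s hs v]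

open Classical in
/-- Tilings as partitions correspond to tilings encoded by their sets of blocks. -/
theorem card_tileCount_eq (hT : ∀ t ∈ T, t ≠ 0) {N : V → ℕ} (c : T → ℕ) :
    (Finset.univ.filter fun m : Tiling T N => tileCount m = c).card
      = (tilingsWith T (Finset.univ : Finset (BlowupVertex N)) c).card := by
  refine Finset.card_bij (fun m _ => m.1.parts) ?_ ?_ ?_
  · intro m hm
    have hm' := (Finset.mem_filter.1 hm).2
    exact mem_tilingsWith.2 ⟨m.2, Finset.supIndep_iff_pairwiseDisjoint.1 m.1.supIndep,
      m.1.sup_parts, fun t => congrFun hm' t⟩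
  · intro m _ m' _ h
    exact Subtype.ext (Finpartition.ext h)
  · intro F hF
    obtain ⟨h1, h2, h3, h4⟩ := mem_tilingsWith.1 hF
    have hF0 : ∅ ∉ F := by
      intro h
      obtain ⟨t, ht, h5⟩ := h1 _ h
      exact hT t ht h5.symm
    exact ⟨⟨⟨F, Finset.supIndep_iff_pairwiseDisjoint.2 h2, h3, hF0⟩, h1⟩,
      Finset.mem_filter.2 ⟨Finset.mem_univ _, funext h4⟩, rfl⟩

end Counting

/-! ### The law of the tile counts -/

section Law

variable {V : Type*} {T : Finset (Multiset V)}

/-- Up to a normalisation, the probability that independent Poisson variables with means `lam t`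
take the values `c t`. -/
def poissonWeight (lam : T → ℝ) (c : T → ℕ) : ℝ := ∏ t, lam t ^ c t / (c t).factorial

theorem poissonWeight_pos {lam : T → ℝ} (h : ∀ t, 0 < lam t) (c : T → ℕ) :
    0 < poissonWeight lam c :=
  Finset.prod_pos fun t _ => div_pos (pow_pos (h t) _) (by positivity)

variable [Fintype V] [DecidableEq V]

instance (T : Finset (Multiset V)) (N : V → ℕ) : DiscreteMeasurableSpace (Tiling T N) :=
  ⟨fun _ => trivial⟩

/-- The vectors of tile counts `c` with `D c = N`. -/
def countVectors (T : Finset (Multiset V)) (N : V → ℕ) : Finset (T → ℕ) :=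
  (Fintype.piFinset fun _ => Finset.range (∑ v, N v + 1)).filter
    fun c => ∀ v, N v = ∑ t : T, c t * t.1.count v

theorem mem_countVectors (hT : ∀ t ∈ T, t ≠ 0) {N : V → ℕ} {c : T → ℕ} :
    c ∈ countVectors T N ↔ ∀ v, N v = ∑ t : T, c t * t.1.count v := by
  rw [countVectors, Finset.mem_filter, Fintype.mem_piFinset, and_iff_right_iff_imp]
  intro h t
  obtain ⟨v, hv⟩ := Multiset.exists_mem_of_ne_zero (hT t.1 t.2)
  rw [Finset.mem_range, Nat.lt_succ_iff]
  calc c t ≤ c t * t.1.count v := Nat.le_mul_of_pos_right _ (Multiset.count_pos.2 hv)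
    _ ≤ ∑ t : T, c t * t.1.count v :=
      Finset.single_le_sum (f := fun t : T => c t * t.1.count v) (fun _ _ => Nat.zero_le _)
        (Finset.mem_univ t)
    _ = N v := (h v).symm
    _ ≤ ∑ v, N v := Finset.single_le_sum (fun _ _ => Nat.zero_le _) (Finset.mem_univ v)

/-- The numbers of tiles are distributed like independent Poisson variables conditioned on
`D X = N`. Rescaling the weights by a gauge `x` and a constant `κ` changes the weights of all
admissible count vectors by the same factor. -/
theorem exists_sum_tilingWeight_eq {δ : ℕ} (hδ : 0 < δ) (hsize : ∀ t ∈ T, Multiset.card t = δ)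
    (w : T → ℝ) (N : V → ℕ) {x : V → ℝ} (hx : ∀ v, 0 < x v) {κ : ℝ} (hκ : 0 < κ) :
    ∃ A : ℝ, 0 < A ∧ ∀ f : (T → ℕ) → ℝ,
      ∑ m : Tiling T N, tilingWeight w m * f (tileCount m)
        = A * ∑ c ∈ countVectors T N,
          poissonWeight (fun t => κ * (w t * tileMonomial x t.1)) c * f c := by
  classical
  have hT := ne_zero_of_card_eq hδ hsize
  -- every admissible vector has the same total number of tiles
  have htot : ∀ c ∈ countVectors T N, ∑ t, c t = (∑ v, N v) / δ := by
    intro c hc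
    rw [mem_countVectors hT] at hc
    refine (Nat.div_eq_of_eq_mul_left hδ ?_).symm
    rw [Finset.sum_congr rfl fun v _ => hc v, Finset.sum_comm, Finset.sum_mul]
    refine Finset.sum_congr rfl fun t _ => ?_
    rw [← Finset.mul_sum, ← hsize t.1 t.2, Multiset.sum_count_eq_card (by simp)]
  refine ⟨(∏ v, ((N v).factorial : ℝ) / x v ^ N v) / κ ^ ((∑ v, N v) / δ), ?_, fun f => ?_⟩
  · exact div_pos (Finset.prod_pos fun v _ => div_pos (by positivity) (pow_pos (hx v) _))
      (pow_pos hκ _)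
  have hcard : ∀ c : T → ℕ, (((Finset.univ.filter fun m : Tiling T N => tileCount m = c).card : ℕ)
      : ℝ) * ∏ t : T, (((c t).factorial : ℝ) * (∏ v, ((t.1.count v).factorial : ℝ)) ^ c t)
      = if ∀ v, N v = ∑ t : T, c t * t.1.count v then ∏ v, ((N v).factorial : ℝ) else 0 := by
    intro c
    have := card_tilingsWith hT (N := N) _ c rfl Finset.univ
    simp only [fiberCard_univ] at this
    rw [card_tileCount_eq hT]
    exact_mod_cast this
  have hmaps : ∀ m ∈ (Finset.univ : Finset (Tiling T N)), tileCount m ∈ countVectors T N := by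
    intro m _
    rw [mem_countVectors hT]
    by_contra hm
    have h := hcard (tileCount m)
    rw [if_neg hm] at h
    rcases mul_eq_zero.1 h with h | h
    · rw [Nat.cast_eq_zero, Finset.card_eq_zero] at h
      exact Finset.notMem_empty m (h ▸ Finset.mem_filter.2 ⟨Finset.mem_univ _, rfl⟩)
    · exact (Finset.prod_pos fun t _ => by positivity).ne' h
  rw [← Finset.sum_fiberwise_of_maps_to hmaps, Finset.mul_sum]
  refine Finset.sum_congr rfl fun c hc => ?_
  have h1 : ∀ m ∈ Finset.univ.filter (fun m : Tiling T N => tileCount m = c),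
      tilingWeight w m * f (tileCount m) = (∏ t : T, w t ^ c t) * f c := by
    intro m hm
    rw [tilingWeight, (Finset.mem_filter.1 hm).2]
  rw [Finset.sum_congr rfl h1, Finset.sum_const, nsmul_eq_mul]
  have h2 := hcard c
  have hc' := (mem_countVectors hT).1 hc
  rw [if_pos hc'] at h2
  have hx' : ∏ v, x v ^ N v = ∏ t : T, (∏ v, x v ^ t.1.count v) ^ c t := by
    rw [Finset.prod_congr rfl fun v _ => by rw [hc' v]]
    simp_rw [← Finset.prod_pow_eq_pow_sum, ← Finset.prod_pow]
    rw [Finset.prod_comm]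
    refine Finset.prod_congr rfl fun t _ => Finset.prod_congr rfl fun v _ => ?_
    rw [← pow_mul, mul_comm]
  have h3 : poissonWeight (fun t => κ * (w t * tileMonomial x t.1)) c
      = κ ^ ((∑ v, N v) / δ) * (∏ t : T, w t ^ c t) * (∏ v, x v ^ N v) /
        ∏ t : T, (((c t).factorial : ℝ) * (∏ v, ((t.1.count v).factorial : ℝ)) ^ c t) := by
    rw [← htot c hc, ← Finset.prod_pow_eq_pow_sum, hx', ← Finset.prod_mul_distrib,
      ← Finset.prod_mul_distrib, ← Finset.prod_div_distrib, poissonWeight]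
    refine Finset.prod_congr rfl fun t _ => ?_
    rw [tileMonomial, Finset.prod_div_distrib, mul_pow, mul_pow, div_pow]
    field_simp
  have hP : (∏ t : T, (((c t).factorial : ℝ) * (∏ v, ((t.1.count v).factorial : ℝ)) ^ c t)) ≠ 0 :=
    (Finset.prod_pos fun t _ => by positivity).ne'
  have hX : (∏ v, x v ^ N v) ≠ 0 := (Finset.prod_pos fun v _ => pow_pos (hx v) _).ne'
  have hκ' : κ ^ ((∑ v, N v) / δ) ≠ 0 := (pow_pos hκ _).ne'
  rw [h3, eq_div_of_mul_eq hP h2, Finset.prod_div_distrib]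
  field_simp

theorem partitionFunction_pos {δ : ℕ} (hδ : 0 < δ) (hsize : ∀ t ∈ T, Multiset.card t = δ)
    {w : T → ℝ} (hw : ∀ t, 0 < w t) {N : V → ℕ} (hN : IsFeasible T N) :
    0 < partitionFunction T w N := by
  obtain ⟨A, hA, h⟩ := exists_sum_tilingWeight_eq hδ hsize w N (x := fun _ => 1)
    (fun _ => one_pos) one_pos
  have h1 := h fun _ => 1
  simp only [mul_one] at h1
  rw [partitionFunction, h1]
  have hT := ne_zero_of_card_eq hδ hsize
  obtain ⟨c, hc⟩ := hN
  refine mul_pos hA (Finset.sum_pos (fun c _ => poissonWeight_pos (fun t => ?_) c)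
    ⟨c, (mem_countVectors hT).2 hc⟩)
  rw [one_mul]
  exact mul_pos (hw t) (Finset.prod_pos fun v _ => by positivity)

theorem tilingWeight_nonneg {w : T → ℝ} (hw : ∀ t, 0 < w t) {N : V → ℕ} (m : Tiling T N) :
    0 ≤ tilingWeight w m := Finset.prod_nonneg fun t _ => pow_nonneg (hw t).le _

theorem isProbabilityMeasure_tilingMeasure {w : T → ℝ} (hw : ∀ t, 0 < w t) {N : V → ℕ}
    (hZ : 0 < partitionFunction T w N) : IsProbabilityMeasure (tilingMeasure T w N) := by
  constructor
  rw [tilingMeasure, Measure.finsetSum_apply]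
  simp only [Measure.smul_apply, measure_univ, smul_eq_mul, mul_one]
  rw [← ENNReal.ofReal_sum_of_nonneg
    (fun m _ => div_nonneg (tilingWeight_nonneg hw m) hZ.le), ← Finset.sum_div]
  change ENNReal.ofReal (partitionFunction T w N / partitionFunction T w N) = 1
  rw [div_self hZ.ne', ENNReal.ofReal_one]

theorem integral_tilingMeasure {w : T → ℝ} (hw : ∀ t, 0 < w t) {N : V → ℕ}
    (hZ : 0 < partitionFunction T w N) (g : Tiling T N → ℝ) :
    ∫ m, g m ∂(tilingMeasure T w N)
      = (∑ m, tilingWeight w m * g m) / partitionFunction T w N := by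
  rw [tilingMeasure, integral_finsetSum_measure]
  · rw [Finset.sum_div]
    refine Finset.sum_congr rfl fun m _ => ?_
    rw [integral_smul_measure, integral_dirac, ENNReal.toReal_ofReal
      (div_nonneg (tilingWeight_nonneg hw m) hZ.le), smul_eq_mul]
    ring
  · intro m _
    exact (integrable_dirac (by simp)).smul_measure ENNReal.ofReal_ne_top

/-- Expectations of functions of the tile counts are conditional Poisson expectations. -/
theorem integral_tileCount {δ : ℕ} (hδ : 0 < δ) (hsize : ∀ t ∈ T, Multiset.card t = δ)
    {w : T → ℝ} (hw : ∀ t, 0 < w t) {N : V → ℕ} (hN : IsFeasible T N) {x : V → ℝ}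
    (hx : ∀ v, 0 < x v) {κ : ℝ} (hκ : 0 < κ) (f : (T → ℕ) → ℝ) :
    ∫ m, f (tileCount m) ∂(tilingMeasure T w N)
      = (∑ c ∈ countVectors T N, poissonWeight (fun t => κ * (w t * tileMonomial x t.1)) c * f c) /
        ∑ c ∈ countVectors T N, poissonWeight (fun t => κ * (w t * tileMonomial x t.1)) c := by
  obtain ⟨A, hA, h⟩ := exists_sum_tilingWeight_eq hδ hsize w N hx hκ
  have h1 := h fun _ => 1
  simp only [mul_one] at h1
  rw [integral_tilingMeasure hw (partitionFunction_pos hδ hsize hw hN), h, partitionFunction, h1,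
    mul_div_mul_left _ _ hA.ne']

end Law

/-! ### The projection `I - C 𝕂` and the covariance matrix -/

section Projection

variable {V : Type*} [Fintype V] [DecidableEq V] {T : Finset (Multiset V)} {w : T → ℝ}

theorem laplacian_mulVec (T : Finset (Multiset V)) (w : T → ℝ) (u : V → ℝ) :
    (laplacian T w).mulVec u
      = (incidence T).mulVec (fun t => w t * (incidence T).transpose.mulVec u t) := by
  rw [laplacian, ← Matrix.mulVec_mulVec, ← Matrix.mulVec_mulVec]
  congr 1
  funext t
  rw [Matrix.mulVec_diagonal]

theorem transpose_mulVec_eq_zero (hw : ∀ t, 0 < w t) {u : V → ℝ}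
    (h : (laplacian T w).mulVec u = 0) : (incidence T).transpose.mulVec u = 0 := by
  have h1 : ∑ t, w t * (incidence T).transpose.mulVec u t ^ 2 = 0 := by
    have h2 : u ⬝ᵥ (laplacian T w).mulVec u = 0 := by rw [h, dotProduct_zero]
    rw [laplacian_mulVec, Matrix.dotProduct_mulVec, ← Matrix.mulVec_transpose] at h2
    rw [← h2]
    exact Finset.sum_congr rfl fun t _ => by ring
  funext t
  have h4 := (Finset.sum_eq_zero_iff_of_nonneg
    (fun t _ => mul_nonneg (hw t).le (sq_nonneg _))).1 h1 t (Finset.mem_univ t)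
  exact pow_eq_zero_iff two_ne_zero |>.1 ((mul_eq_zero.1 h4).resolve_left (hw t).ne')

theorem laplacianOnImage_apply_inverse (hw : ∀ t, 0 < w t) (y : imD T) :
    laplacianOnImage T w (Ring.inverse (laplacianOnImage T w) y) = y := by
  have h := Ring.mul_inverse_cancel _ (isUnit_laplacianOnImage T w hw)
  exact congrArg (fun f : Module.End ℝ (imD T) => f y) h

/-- Every element of `Im D*` is the image under `D*` of an element of `Im D`. -/
theorem exists_mem_imD_transpose_eq (z : V → ℝ) :
    ∃ u : imD T, (incidence T).transpose.mulVec u = (incidence T).transpose.mulVec z := by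
  have h1 : ∀ t : T, (0 : ℝ) < (fun _ => 1 : T → ℝ) t := fun _ => one_pos
  refine ⟨Ring.inverse (laplacianOnImage T fun _ => 1)
    ⟨(laplacian T fun _ => 1).mulVec z, laplacian_mem_imD T _ z⟩, ?_⟩
  rw [← sub_eq_zero, ← Matrix.mulVec_sub]
  refine transpose_mulVec_eq_zero h1 ?_
  rw [Matrix.mulVec_sub, sub_eq_zero]
  exact congrArg Subtype.val (laplacianOnImage_apply_inverse h1
    ⟨(laplacian T fun _ => 1).mulVec z, laplacian_mem_imD T _ z⟩)

theorem exists_kernelMatrix_mulVec (hw : ∀ t, 0 < w t) (x : T → ℝ) :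
    ∃ u : V → ℝ, (kernelMatrix T w).mulVec x = (incidence T).transpose.mulVec u ∧
      (laplacian T w).mulVec u = (incidence T).mulVec x := by
  refine ⟨Ring.inverse (laplacianOnImage T w) ((incidence T).mulVecLin.rangeRestrict x), ?_, ?_⟩
  · rw [kernelMatrix, LinearMap.toMatrix'_mulVec]
    rfl
  · exact congrArg Subtype.val (laplacianOnImage_apply_inverse hw
      ((incidence T).mulVecLin.rangeRestrict x))

theorem complProjection_mulVec (T : Finset (Multiset V)) (w x : T → ℝ) :
    (complProjection T w).mulVec x = fun t => x t - w t * (kernelMatrix T w).mulVec x t := by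
  rw [complProjection, Matrix.sub_mulVec, Matrix.one_mulVec, ← Matrix.mulVec_mulVec]
  funext t
  rw [Pi.sub_apply, Matrix.mulVec_diagonal]

theorem incidence_complProjection (hw : ∀ t, 0 < w t) (x : T → ℝ) :
    (incidence T).mulVec ((complProjection T w).mulVec x) = 0 := by
  obtain ⟨u, h1, h2⟩ := exists_kernelMatrix_mulVec hw x
  have h3 : (complProjection T w).mulVec x
      = x - fun t => w t * (incidence T).transpose.mulVec u t := by
    rw [complProjection_mulVec, h1]
    rfl
  rw [h3, Matrix.mulVec_sub, ← laplacian_mulVec, h2, sub_self]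

theorem complProjection_of_mem_ker (hw : ∀ t, 0 < w t) {x : T → ℝ}
    (hx : (incidence T).mulVec x = 0) : (complProjection T w).mulVec x = x := by
  obtain ⟨u, h1, h2⟩ := exists_kernelMatrix_mulVec hw x
  rw [complProjection_mulVec, h1, transpose_mulVec_eq_zero hw (h2.trans hx)]
  simp

theorem complProjection_weight_mul_transpose (hw : ∀ t, 0 < w t) (z : V → ℝ) :
    (complProjection T w).mulVec (fun t => w t * (incidence T).transpose.mulVec z t) = 0 := by
  obtain ⟨u, h1, h2⟩ := exists_kernelMatrix_mulVec hw
    (fun t => w t * (incidence T).transpose.mulVec z t)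
  rw [← laplacian_mulVec, ← sub_eq_zero, ← Matrix.mulVec_sub] at h2
  have h3 := transpose_mulVec_eq_zero hw h2
  rw [Matrix.mulVec_sub, sub_eq_zero] at h3
  rw [complProjection_mulVec, h1, h3]
  simp
  rfl

theorem isIdempotentElem_complProjection (hw : ∀ t, 0 < w t) :
    IsIdempotentElem (complProjection T w) := by
  refine Matrix.ext_of_mulVec_single fun t => ?_
  rw [← Matrix.mulVec_mulVec]
  exact complProjection_of_mem_ker hw (incidence_complProjection hw _)

theorem ker_complProjection (hw : ∀ t, 0 < w t) :
    LinearMap.ker (complProjection T w).mulVecLin =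
      (LinearMap.range (incidence T).transpose.mulVecLin).map (Matrix.diagonal w).mulVecLin := by
  ext x
  rw [LinearMap.mem_ker, Matrix.mulVecLin_apply, Submodule.mem_map]
  constructor
  · intro h
    obtain ⟨u, h1, -⟩ := exists_kernelMatrix_mulVec hw x
    refine ⟨_, ⟨u, rfl⟩, ?_⟩
    funext t
    have h2 := congrFun h t
    rw [complProjection_mulVec, h1] at h2
    rw [Matrix.mulVecLin_apply, Matrix.mulVec_diagonal, Matrix.mulVecLin_apply]
    exact (sub_eq_zero.1 h2).symm
  · rintro ⟨_, ⟨u, rfl⟩, rfl⟩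
    rw [← complProjection_weight_mul_transpose hw u]
    congr 1
    funext t
    rw [Matrix.mulVecLin_apply, Matrix.mulVec_diagonal, Matrix.mulVecLin_apply]

theorem range_complProjection (hw : ∀ t, 0 < w t) :
    LinearMap.range (complProjection T w).mulVecLin = LinearMap.ker (incidence T).mulVecLin := by
  ext x
  constructor
  · rintro ⟨y, rfl⟩
    exact incidence_complProjection hw y
  · intro hx
    exact ⟨x, complProjection_of_mem_ker hw hx⟩

/-- The covariance form is the squared norm, with weights `1 / w`, of the projection of `C ξ` to
the kernel of `D`. -/
theorem dotProduct_covMatrix_mulVec (hw : ∀ t, 0 < w t) (ξ η : T → ℝ) :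
    ξ ⬝ᵥ (covMatrix T w).mulVec η
      = ∑ t, (complProjection T w).mulVec (fun s => w s * ξ s) t *
          (complProjection T w).mulVec (fun s => w s * η s) t / w t := by
  have h0 : ξ ⬝ᵥ (covMatrix T w).mulVec η
      = ∑ t, (complProjection T w).mulVec (fun s => w s * ξ s) t * η t := by
    simp only [dotProduct, Matrix.mulVec, covMatrix, Matrix.of_apply, Finset.mul_sum,
      Finset.sum_mul]
    rw [Finset.sum_comm]
    exact Finset.sum_congr rfl fun t _ => Finset.sum_congr rfl fun s _ => by ring
  set p := (complProjection T w).mulVec (fun s => w s * ξ s) with hp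
  -- `C η` and its projection differ by an element of `C Im D*`, which is orthogonal to `ker D`
  obtain ⟨u, h1, -⟩ := exists_kernelMatrix_mulVec hw (fun s => w s * η s)
  have h2 : ∑ t, p t * (incidence T).transpose.mulVec u t = 0 := by
    change p ⬝ᵥ (incidence T).transpose.mulVec u = 0
    rw [Matrix.mulVec_transpose, dotProduct_comm, ← Matrix.dotProduct_mulVec, hp,
      incidence_complProjection hw, dotProduct_zero]
  rw [h0, ← sub_eq_zero, ← h2, ← Finset.sum_sub_distrib]
  refine Finset.sum_congr rfl fun t _ => ?_
  rw [complProjection_mulVec, h1]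
  have := (hw t).ne'
  field_simp
  ring

theorem posSemidef_covMatrix (hw : ∀ t, 0 < w t) : (covMatrix T w).PosSemidef := by
  have hsymm : ∀ ξ η : T → ℝ, ξ ⬝ᵥ (covMatrix T w).mulVec η = η ⬝ᵥ (covMatrix T w).mulVec ξ := by
    intro ξ η
    rw [dotProduct_covMatrix_mulVec hw, dotProduct_covMatrix_mulVec hw]
    exact Finset.sum_congr rfl fun t _ => by ring
  refine Matrix.PosSemidef.of_dotProduct_mulVec_nonneg ?_ fun ξ => ?_
  · ext s t
    have h := hsymm (Pi.single t 1) (Pi.single s 1)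
    simpa using h
  · rw [star_trivial, dotProduct_covMatrix_mulVec hw]
    exact Finset.sum_nonneg fun t _ => div_nonneg (mul_self_nonneg _) (hw t).le

end Projection

/-! ### Critical-gauge weights -/

section Gauge

variable {V : Type*} [DecidableEq V] {T : Finset (Multiset V)} {w : T → ℝ}

theorem incidence_mulVec_apply (T : Finset (Multiset V)) (y : T → ℝ) (v : V) :
    (incidence T).mulVec y v = ∑ t : T, y t * (t.1.count v : ℝ) := by
  simp only [Matrix.mulVec, dotProduct, incidence, Matrix.of_apply]
  exact Finset.sum_congr rfl fun t _ => mul_comm _ _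

variable [Fintype V]

/-- The weights obtained from `w` by the gauge `x = exp u`. -/
def expWeights (T : Finset (Multiset V)) (w : T → ℝ) (u : V → ℝ) (t : T) : ℝ :=
  w t * tileMonomial (fun _ => 1) t.1 * Real.exp ((incidence T).transpose.mulVec u t)

theorem transpose_mulVec_apply (T : Finset (Multiset V)) (u : V → ℝ) (t : T) :
    (incidence T).transpose.mulVec u t = ∑ v, (t.1.count v : ℝ) * u v := by
  simp only [Matrix.mulVec, dotProduct, incidence, Matrix.transpose_apply, Matrix.of_apply]

theorem weight_mul_tileMonomial_exp (w : T → ℝ) (u : V → ℝ) (t : T) :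
    w t * tileMonomial (fun v => Real.exp (u v)) t.1 = expWeights T w u t := by
  rw [expWeights, transpose_mulVec_apply, Real.exp_sum, mul_assoc, tileMonomial, tileMonomial,
    ← Finset.prod_mul_distrib]
  congr 1
  refine Finset.prod_congr rfl fun v _ => ?_
  rw [← Real.exp_nat_mul]
  ring

theorem expWeights_zero_pos (hw : ∀ t, 0 < w t) (t : T) :
    0 < w t * tileMonomial (fun _ => 1) t.1 :=
  mul_pos (hw t) (Finset.prod_pos fun v _ => by positivity)

theorem isCriticalGauge_expWeights {β : V → ℝ} {u : V → ℝ}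
    (h : (incidence T).mulVec (expWeights T w u) = β) :
    IsCriticalGauge T w β (expWeights T w u) := by
  refine ⟨⟨fun v => Real.exp (u v), fun v => Real.exp_pos _, fun t =>
    (weight_mul_tileMonomial_exp w u t).symm⟩, fun v => ?_⟩
  rw [← incidence_mulVec_apply, h]

theorem IsCriticalGauge.pos (hw : ∀ t, 0 < w t) {β : V → ℝ} {w' : T → ℝ}
    (h : IsCriticalGauge T w β w') (t : T) : 0 < w' t := by
  obtain ⟨⟨x, hx, h1⟩, -⟩ := h
  rw [h1]
  exact mul_pos (hw t) (Finset.prod_pos fun v _ => div_pos (pow_pos (hx v) _) (by positivity))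

theorem IsCriticalGauge.exists_eq_expWeights {β : V → ℝ} {w' : T → ℝ}
    (h : IsCriticalGauge T w β w') : ∃ u : V → ℝ, w' = expWeights T w u := by
  obtain ⟨⟨x, hx, h1⟩, -⟩ := h
  refine ⟨fun v => Real.log (x v), funext fun t => ?_⟩
  rw [h1, ← weight_mul_tileMonomial_exp]
  simp only [Real.exp_log (hx _)]

/-- Critical-gauge weights are unique, because `u ↦ D (expWeights u)` is the gradient of a convex
function that is strictly convex modulo the kernel of `D*`. -/
theorem IsCriticalGauge.unique (hw : ∀ t, 0 < w t) {β : V → ℝ} {w₁ w₂ : T → ℝ}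
    (h₁ : IsCriticalGauge T w β w₁) (h₂ : IsCriticalGauge T w β w₂) : w₁ = w₂ := by
  obtain ⟨u₁, rfl⟩ := h₁.exists_eq_expWeights
  obtain ⟨u₂, rfl⟩ := h₂.exists_eq_expWeights
  set y₁ := (incidence T).transpose.mulVec u₁ with hy₁
  set y₂ := (incidence T).transpose.mulVec u₂ with hy₂
  have hterm : ∀ t, 0 ≤ (expWeights T w u₁ t - expWeights T w u₂ t) * (y₁ t - y₂ t) := by
    intro t
    have ha := expWeights_zero_pos hw t
    simp only [expWeights, ← hy₁, ← hy₂]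
    rcases le_total (y₁ t) (y₂ t) with h | h
    · refine mul_nonneg_of_nonpos_of_nonpos ?_ (sub_nonpos.2 h)
      exact sub_nonpos.2 (mul_le_mul_of_nonneg_left (Real.exp_le_exp.2 h) ha.le)
    · refine mul_nonneg ?_ (sub_nonneg.2 h)
      exact sub_nonneg.2 (mul_le_mul_of_nonneg_left (Real.exp_le_exp.2 h) ha.le)
  have hsum : ∑ t, (expWeights T w u₁ t - expWeights T w u₂ t) * (y₁ t - y₂ t) = 0 := by
    have hD : (incidence T).mulVec (expWeights T w u₁ - expWeights T w u₂) = 0 := by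
      funext v
      rw [Matrix.mulVec_sub, Pi.sub_apply, incidence_mulVec_apply, incidence_mulVec_apply,
        h₁.2 v, h₂.2 v, sub_self, Pi.zero_apply]
    have : (expWeights T w u₁ - expWeights T w u₂) ⬝ᵥ
        (incidence T).transpose.mulVec (u₁ - u₂) = 0 := by
      rw [Matrix.mulVec_transpose, dotProduct_comm, ← Matrix.dotProduct_mulVec, hD,
        dotProduct_zero]
    rw [Matrix.mulVec_sub] at this
    exact this
  funext t
  have h := (Finset.sum_eq_zero_iff_of_nonneg fun t _ => hterm t).1 hsum t (Finset.mem_univ t)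
  rcases mul_eq_zero.1 h with h | h
  · exact sub_eq_zero.1 h
  · simp only [expWeights, ← hy₁, ← hy₂, sub_eq_zero.1 h]

/-- Coercivity of one summand of the convex function that critical-gauge weights minimise. -/
theorem mul_exp_sub_mul_lower {a c : ℝ} (ha : 0 < a) (hc : 0 < c) (y : ℝ) :
    c * |y| - 2 * c ^ 2 / a ≤ a * Real.exp y - c * y := by
  have h0 : 0 ≤ 2 * c ^ 2 / a := by positivity
  rcases le_total y 0 with h | h
  · rw [abs_of_nonpos h]
    have := mul_pos ha (Real.exp_pos y)
    linarith
  · rw [abs_of_nonneg h]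
    have h1 : y ^ 2 / 2 ≤ Real.exp y := by
      have := Real.quadratic_le_exp_of_nonneg h
      linarith
    have h2 : a * (y ^ 2 / 2) - 2 * c * y + 2 * c ^ 2 / a = a / 2 * (y - 2 * c / a) ^ 2 := by
      field_simp
      ring
    have h3 : 0 ≤ a / 2 * (y - 2 * c / a) ^ 2 := by positivity
    nlinarith [mul_le_mul_of_nonneg_left h1 ha.le]

/-- Existence of critical-gauge weights. Write `α = D c` with `c > 0`. The function
`y ↦ ∑ t, (a t * exp (y t) - c t * y t)` is coercive, and at a minimum on `Im D*` its gradient is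
orthogonal to `Im D*`, that is, in the kernel of `D`. -/
theorem exists_isCriticalGauge (hw : ∀ t, 0 < w t) {α : V → ℝ} (hα : InFeasibleCone T α) :
    ∃ w', IsCriticalGauge T w α w' := by
  obtain ⟨c, hc, hcα⟩ := hα
  set a : T → ℝ := fun t => w t * tileMonomial (fun _ => 1) t.1 with ha
  have ha0 : ∀ t, 0 < a t := expWeights_zero_pos hw
  set φ : (T → ℝ) → ℝ := fun y => ∑ t, (a t * Real.exp (y t) - c t * y t) with hφ
  have hφc : Continuous φ := by fun_prop
  set S := LinearMap.range (incidence T).transpose.mulVecLin with hS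
  have hSc : IsClosed (S : Set (T → ℝ)) := S.closed_of_finiteDimensional
  set B : ℝ := ∑ t, a t + ∑ t, 2 * c t ^ 2 / a t with hB
  have hB0 : 0 ≤ B := add_nonneg (Finset.sum_nonneg fun t _ => (ha0 t).le)
    (Finset.sum_nonneg fun t _ => div_nonneg (by positivity) (ha0 t).le)
  set Q : Set (T → ℝ) := Set.univ.pi fun t => Set.Icc (-(B / c t)) (B / c t) with hQ
  have hQc : IsCompact Q := isCompact_univ_pi fun t => isCompact_Icc
  have h0Q : (0 : T → ℝ) ∈ Q := fun t _ => by
    have := div_nonneg hB0 (hc t).le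
    exact ⟨by simpa using this, this⟩
  obtain ⟨y, hy, hmin⟩ := (hQc.inter_right hSc).exists_isMinOn ⟨0, h0Q, S.zero_mem⟩
    hφc.continuousOn
  have hmin' : ∀ z ∈ S, φ y ≤ φ z := by
    intro z hz
    by_cases hzQ : z ∈ Q
    · exact hmin ⟨hzQ, hz⟩
    · refine (hmin ⟨h0Q, S.zero_mem⟩).trans ?_
      obtain ⟨t, ht⟩ : ∃ t, B / c t < |z t| := by
        by_contra! h
        exact hzQ fun t _ => abs_le.1 (h t)
      have h1 : B < c t * |z t| := by rwa [div_lt_iff₀' (hc t)] at ht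
      have h2 : ∑ s, (c s * |z s| - 2 * c s ^ 2 / a s) ≤ φ z :=
        Finset.sum_le_sum fun s _ => mul_exp_sub_mul_lower (ha0 s) (hc s) _
      rw [Finset.sum_sub_distrib] at h2
      have h3 : c t * |z t| ≤ ∑ s, c s * |z s| :=
        Finset.single_le_sum (f := fun s => c s * |z s|)
          (fun s _ => mul_nonneg (hc s).le (abs_nonneg _)) (Finset.mem_univ t)
      have h4 : φ 0 = ∑ t, a t := by simp [hφ]
      change φ 0 ≤ φ z
      linarith
  obtain ⟨u, hu⟩ := hy.2
  rw [Matrix.mulVecLin_apply] at hu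
  refine ⟨_, isCriticalGauge_expWeights (u := u) (funext fun v => ?_)⟩
  -- the derivative of `φ` at `y` in the direction of the image under `D*` of a basis vector
  have hd : HasDerivAt (fun s : ℝ => φ (y + s • (incidence T).transpose.mulVec (Pi.single v 1)))
      (∑ t, (a t * (Real.exp (y t) * (t.1.count v : ℝ)) - c t * (t.1.count v : ℝ))) 0 := by
    have hlin : ∀ t : T, HasDerivAt
        (fun s : ℝ => (y + s • (incidence T).transpose.mulVec (Pi.single v 1)) t)
        (t.1.count v : ℝ) 0 := by
      intro t
      have h1 : (incidence T).transpose.mulVec (Pi.single v 1) t = (t.1.count v : ℝ) := by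
        rw [transpose_mulVec_apply]
        simp [Pi.single_apply]
      simp only [Pi.add_apply, Pi.smul_apply, smul_eq_mul, h1]
      simpa using ((hasDerivAt_id (0 : ℝ)).mul_const (t.1.count v : ℝ)).const_add (y t)
    refine HasDerivAt.fun_sum fun t _ => ?_
    have h2 := ((hlin t).exp.const_mul (a t)).fun_sub ((hlin t).const_mul (c t))
    simpa using h2
  have hloc : IsLocalMin
      (fun s : ℝ => φ (y + s • (incidence T).transpose.mulVec (Pi.single v 1))) 0 := by
    refine Filter.Eventually.of_forall fun s => ?_
    simp only [zero_smul, add_zero]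
    exact hmin' _ (S.add_mem hy.2 (S.smul_mem s ⟨_, rfl⟩))
  have hz := hloc.hasDerivAt_eq_zero hd
  rw [Finset.sum_sub_distrib, sub_eq_zero, ← hcα v] at hz
  rw [incidence_mulVec_apply, ← hz]
  refine Finset.sum_congr rfl fun t _ => ?_
  rw [expWeights, hu]
  ring

/-- Near `α`, and inside the image of `D`, critical-gauge weights exist and depend on the vector in
a Lipschitz way at `α`: this is the inverse function theorem, because the derivative of
`u ↦ D (expWeights u)` on `Im D` is the tiling laplacian. -/
theorem exists_local_criticalGauge (hw : ∀ t, 0 < w t) {α : imD T} {wc : T → ℝ}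
    (h : IsCriticalGauge T w α wc) :
    ∃ Φ : imD T → T → ℝ, (∀ᶠ β : imD T in 𝓝 α, IsCriticalGauge T w β (Φ β)) ∧
      (fun β => Φ β - wc) =O[𝓝 α] fun β : imD T => β - α := by
  have hwc := h.pos hw
  obtain ⟨z, rfl⟩ := h.exists_eq_expWeights
  obtain ⟨u, hu⟩ := exists_mem_imD_transpose_eq (T := T) z
  have hzu : expWeights T w z = expWeights T w u := by
    funext t
    rw [expWeights, expWeights, hu]
  rw [hzu] at h hwc ⊢
  let Dt : imD T →L[ℝ] (T → ℝ) :=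
    ((incidence T).transpose.mulVecLin ∘ₗ (imD T).subtype).toContinuousLinearMap
  let Dr : (T → ℝ) →L[ℝ] imD T := (incidence T).mulVecLin.rangeRestrict.toContinuousLinearMap
  let E : imD T → T → ℝ := fun b => expWeights T w b
  have hE : HasStrictFDerivAt E (ContinuousLinearMap.pi fun t =>
      expWeights T w u t • (ContinuousLinearMap.proj t).comp Dt) u := by
    refine hasStrictFDerivAt_pi.2 fun t => ?_
    have h1 : HasStrictFDerivAt (fun b : imD T => Dt b t)
        ((ContinuousLinearMap.proj t).comp Dt) u :=
      ((ContinuousLinearMap.proj (R := ℝ) (φ := fun _ : T => ℝ) t).comp Dt).hasStrictFDerivAt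
    have h2 := h1.exp.const_mul (w t * tileMonomial (fun _ => 1) t.1)
    rw [smul_smul] at h2
    exact h2
  let L : imD T ≃L[ℝ] imD T := (LinearEquiv.ofBijective (laplacianOnImage T (expWeights T w u))
    ((Module.End.isUnit_iff _).1 (isUnit_laplacianOnImage T _ hwc))).toContinuousLinearEquiv
  have hF : HasStrictFDerivAt (fun b => Dr (E b)) (L : imD T →L[ℝ] imD T) u := by
    have h1 := Dr.hasStrictFDerivAt.comp u hE
    have h2 : (L : imD T →L[ℝ] imD T) = Dr.comp (ContinuousLinearMap.pi fun t =>
        expWeights T w u t • (ContinuousLinearMap.proj t).comp Dt) := by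
      ext1 b
      refine Subtype.ext ?_
      exact laplacian_mulVec T _ b
    rw [h2]
    exact h1
  have hFu : Dr (E u) = α := by
    refine Subtype.ext (funext fun v => ?_)
    exact (incidence_mulVec_apply T _ v).trans (h.2 v)
  refine ⟨fun β => E (hF.localInverse _ _ _ β), ?_, ?_⟩
  · have h1 := hF.eventually_right_inverse
    rw [hFu] at h1
    filter_upwards [h1] with β hβ
    exact isCriticalGauge_expWeights (congrArg Subtype.val hβ)
  · have h2 := hF.to_localInverse.hasFDerivAt.isBigO_sub
    have h3 := hE.hasFDerivAt.isBigO_sub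
    rw [hFu] at h2
    have hinv : hF.localInverse _ _ _ α = u := by
      have := hF.localInverse_apply_image
      rwa [hFu] at this
    have hcont : Tendsto (hF.localInverse _ _ _) (𝓝 α) (𝓝 u) := by
      have := hF.localInverse_tendsto
      rwa [hFu] at this
    rw [hinv] at h2
    exact (h3.comp_tendsto hcont).trans h2

end Gauge

/-! ### Local limits of Poisson probabilities -/

section Poisson

/-- A Chernoff bound for a single Poisson probability, on the scale of the standard deviation. -/
theorem pow_mul_exp_neg_le {lam : ℝ} (hlam : 1 ≤ lam) (n : ℕ) :
    lam ^ n * Real.exp (-lam)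
      ≤ (n / Real.exp 1) ^ n * Real.exp (1 - |(n : ℝ) - lam| / √lam) := by
  have hl0 : 0 < lam := by linarith
  have hs : 1 ≤ √lam := Real.one_le_sqrt.2 hlam
  have hs0 : 0 < √lam := by linarith
  have hss : √lam * √lam = lam := Real.mul_self_sqrt hl0.le
  -- an exponential tilt of the mean by the factor `exp θ`
  have key : ∀ θ : ℝ, lam ^ n * Real.exp (-lam)
      ≤ (n / Real.exp 1) ^ n * Real.exp (lam * (Real.exp θ - 1) - θ * n) := by
    intro θ
    rcases Nat.eq_zero_or_pos n with rfl | hn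
    · simp only [pow_zero, one_mul, Nat.cast_zero, mul_zero, sub_zero]
      exact Real.exp_le_exp.2 (by nlinarith [Real.exp_pos θ])
    · have hn0 : (0 : ℝ) < n := by exact_mod_cast hn
      have h1 : lam * Real.exp θ / n ≤ Real.exp (lam * Real.exp θ / n - 1) := by
        have := Real.add_one_le_exp (lam * Real.exp θ / n - 1)
        linarith
      have h2 := pow_le_pow_left₀ (by positivity) h1 n
      rw [← Real.exp_nat_mul, div_pow, mul_pow, ← Real.exp_nat_mul, div_le_iff₀ (by positivity)]
        at h2
      have h3 : (n : ℝ) * (lam * Real.exp θ / n - 1) = lam * Real.exp θ - n := by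
        field_simp
      rw [h3] at h2
      have h4 : (n / Real.exp 1 : ℝ) ^ n = n ^ n * Real.exp (-n) := by
        rw [div_pow, ← Real.exp_nat_mul, mul_one, Real.exp_neg, div_eq_mul_inv]
      rw [h4]
      have h5 := mul_le_mul_of_nonneg_right h2 (Real.exp_pos (-lam - n * θ)).le
      calc lam ^ n * Real.exp (-lam)
          = lam ^ n * Real.exp (n * θ) * Real.exp (-lam - n * θ) := by
            rw [mul_assoc, ← Real.exp_add]; ring_nf
        _ ≤ _ := h5
        _ = _ := by
            rw [mul_comm (Real.exp _) _, mul_assoc, mul_assoc, ← Real.exp_add, ← Real.exp_add]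
            ring_nf
  have fin : ∀ θ : ℝ, |θ| = 1 / √lam → θ * (n - lam) = |(n : ℝ) - lam| / √lam →
      lam ^ n * Real.exp (-lam)
      ≤ (n / Real.exp 1) ^ n * Real.exp (1 - |(n : ℝ) - lam| / √lam) := by
    intro θ h1 h2
    refine (key θ).trans (mul_le_mul_of_nonneg_left (Real.exp_le_exp.2 ?_) (by positivity))
    have h3 : |θ| ≤ 1 := by
      rw [h1, div_le_one hs0]
      exact hs
    have h4 := (abs_le.1 (Real.abs_exp_sub_one_sub_id_le h3)).2
    have h5 : lam * θ ^ 2 = 1 := by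
      rw [← sq_abs, h1, div_pow, Real.sq_sqrt hl0.le]
      field_simp
    rw [← h2]
    nlinarith [mul_le_mul_of_nonneg_left h4 hl0.le]
  -- the choice `θ = ±1 / √lam` gains one factor `exp (-1)` per standard deviation
  rcases le_total 0 ((n : ℝ) - lam) with h | h
  · refine fin (1 / √lam) (abs_of_nonneg (by positivity)) ?_
    rw [abs_of_nonneg h]
    ring
  · refine fin (-(1 / √lam)) ?_ ?_
    · rw [abs_neg, abs_of_nonneg (by positivity)]
    · rw [abs_of_nonpos h]
      ring

/-- The probability that a Poisson variable with mean `lam` has integer value `⌊x⌋`, multiplied by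
`√(2π lam)` and regarded as a function of a real variable `x`. -/
def poissonDensity (lam x : ℝ) : ℝ :=
  if 0 ≤ x then √(2 * Real.pi * lam) * (Real.exp (-lam) * (lam ^ ⌊x⌋₊ / (⌊x⌋₊).factorial)) else 0

theorem poissonDensity_natCast (lam : ℝ) (n : ℕ) : poissonDensity lam n
    = √(2 * Real.pi * lam) * (Real.exp (-lam) * (lam ^ n / n.factorial)) := by
  rw [poissonDensity, if_pos (Nat.cast_nonneg n), Nat.floor_natCast]

theorem poissonDensity_nonneg {lam : ℝ} (hlam : 0 ≤ lam) (x : ℝ) : 0 ≤ poissonDensity lam x := by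
  rw [poissonDensity]
  split_ifs
  · positivity
  · exact le_rfl

theorem measurable_poissonDensity (lam : ℝ) : Measurable (poissonDensity lam) := by
  refine Measurable.ite measurableSet_Ici ?_ measurable_const
  exact (measurable_from_top (f := fun n : ℕ =>
    √(2 * Real.pi * lam) * (Real.exp (-lam) * (lam ^ n / n.factorial)))).comp Nat.measurable_floor

theorem poissonDensity_natCast_le {lam : ℝ} (hlam : 1 ≤ lam) (n : ℕ) :
    poissonDensity lam n ≤ 6 * Real.exp 1 * Real.exp (-(|(n : ℝ) - lam| / √lam) / 2) := by
  have hl0 : 0 < lam := by linarith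
  have hs : 1 ≤ √lam := Real.one_le_sqrt.2 hlam
  have hs0 : 0 < √lam := by linarith
  have hss : √lam * √lam = lam := Real.mul_self_sqrt hl0.le
  have hmain := pow_mul_exp_neg_le hlam n
  set d := |(n : ℝ) - lam| / √lam with hd
  have hd0 : 0 ≤ d := by positivity
  have hfac := Stirling.le_factorial_stirling n
  -- the Stirling prefactor is absorbed by half of the exponential decay
  have hpre : √(2 * Real.pi * lam) * ((n / Real.exp 1) ^ n / n.factorial) ≤ 2 + 3 * d := by
    rcases Nat.eq_zero_or_pos n with rfl | hn
    · have h1 : d = √lam := by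
        rw [hd, Nat.cast_zero, zero_sub, abs_neg, abs_of_pos hl0, div_eq_iff hs0.ne', hss]
      have h2 : √(2 * Real.pi * lam) ≤ 3 * d := by
        rw [h1]
        refine Real.sqrt_le_iff.2 ⟨by positivity, ?_⟩
        rw [mul_pow, Real.sq_sqrt hl0.le]
        nlinarith [Real.pi_lt_four]
      simp
      linarith
    · have hn0 : (0 : ℝ) < n := by exact_mod_cast hn
      have h1 : (n / Real.exp 1 : ℝ) ^ n / n.factorial ≤ 1 / √(2 * Real.pi * n) := by
        rw [div_le_div_iff₀ (by positivity) (by positivity)]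
        linarith
      refine (mul_le_mul_of_nonneg_left h1 (by positivity)).trans ?_
      rw [mul_one_div, ← Real.sqrt_div (by positivity)]
      refine Real.sqrt_le_iff.2 ⟨by positivity, ?_⟩
      have hpi := Real.pi_pos
      rw [mul_div_mul_left _ _ (by positivity), div_le_iff₀ hn0]
      rcases le_total lam (4 * n) with h | h
      · nlinarith [mul_nonneg hd0 hn0.le, mul_nonneg (mul_nonneg hd0 hd0) hn0.le]
      · have h2 : 3 / 4 * √lam ≤ d := by
          rw [hd, le_div_iff₀ hs0, mul_assoc, hss]
          refine le_trans ?_ (neg_le_abs _)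
          linarith
        have h3 : (3 / 4 * √lam) ^ 2 ≤ d ^ 2 := pow_le_pow_left₀ (by positivity) h2 2
        rw [mul_pow, Real.sq_sqrt hl0.le] at h3
        have hn1 : (1 : ℝ) ≤ n := by exact_mod_cast hn
        have h4 : lam ≤ (2 + 3 * d) ^ 2 := by nlinarith
        nlinarith [sq_nonneg (2 + 3 * d)]
  have h2 : 2 + 3 * d ≤ 6 * Real.exp (d / 2) := by
    have := Real.add_one_le_exp (d / 2)
    linarith
  rw [poissonDensity_natCast]
  calc √(2 * Real.pi * lam) * (Real.exp (-lam) * (lam ^ n / n.factorial))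
      = √(2 * Real.pi * lam) * ((lam ^ n * Real.exp (-lam)) / n.factorial) := by ring
    _ ≤ √(2 * Real.pi * lam) * (((n / Real.exp 1) ^ n * Real.exp (1 - d)) / n.factorial) := by
        gcongr
    _ = √(2 * Real.pi * lam) * ((n / Real.exp 1) ^ n / n.factorial) * Real.exp (1 - d) := by ring
    _ ≤ 6 * Real.exp (d / 2) * Real.exp (1 - d) :=
        mul_le_mul_of_nonneg_right (hpre.trans h2) (Real.exp_pos _).le
    _ = _ := by
        rw [mul_assoc, mul_assoc, ← Real.exp_add, ← Real.exp_add]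
        ring_nf

theorem abs_floor_sub_le {x : ℝ} (hx : 0 ≤ x) : |(⌊x⌋₊ : ℝ) - x| ≤ 1 := by
  rw [abs_le]
  constructor <;> linarith [Nat.floor_le hx, Nat.lt_floor_add_one x]

/-- The Poisson density decays exponentially on the scale of the standard deviation, uniformly in
the mean. -/
theorem poissonDensity_le {lam : ℝ} (hlam : 1 ≤ lam) (x : ℝ) :
    poissonDensity lam x ≤ 6 * Real.exp 2 * Real.exp (-(|x - lam| / √lam) / 2) := by
  by_cases hx : 0 ≤ x
  · have h1 : poissonDensity lam x = poissonDensity lam (⌊x⌋₊ : ℕ) := by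
      rw [poissonDensity_natCast, poissonDensity, if_pos hx]
    rw [h1]
    refine (poissonDensity_natCast_le hlam _).trans ?_
    rw [mul_assoc, mul_assoc, ← Real.exp_add, ← Real.exp_add]
    refine mul_le_mul_of_nonneg_left (Real.exp_le_exp.2 ?_) (by norm_num)
    have hs : 1 ≤ √lam := Real.one_le_sqrt.2 hlam
    have h2 : |x - lam| ≤ |(⌊x⌋₊ : ℝ) - lam| + 1 := by
      have h3 := abs_floor_sub_le hx
      rw [abs_sub_comm] at h3
      have := abs_add_le (x - ⌊x⌋₊) (⌊x⌋₊ - lam)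
      rw [sub_add_sub_cancel] at this
      linarith
    have h4 : |x - lam| / √lam ≤ |(⌊x⌋₊ : ℝ) - lam| / √lam + 1 := by
      rw [div_add_one (by positivity)]
      gcongr
      linarith
    linarith
  · rw [poissonDensity, if_neg hx]
    positivity

/-- The local central limit theorem for Poisson variables with integer values `n k`. -/
theorem tendsto_poissonDensity_natCast {lam : ℕ → ℝ} {n : ℕ → ℕ} {ζ : ℝ}
    (hlam : Tendsto lam atTop atTop)
    (h : Tendsto (fun k => ((n k : ℝ) - lam k) / √(lam k)) atTop (𝓝 ζ)) :
    Tendsto (fun k => poissonDensity (lam k) (n k)) atTop (𝓝 (Real.exp (-ζ ^ 2 / 2))) := by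
  have hpos : ∀ᶠ k in atTop, 0 < lam k := hlam.eventually_gt_atTop 0
  have hsqrt : Tendsto (fun k => √(lam k)) atTop atTop := Real.tendsto_sqrt_atTop.comp hlam
  have hinv : Tendsto (fun k => (√(lam k))⁻¹) atTop (𝓝 0) := tendsto_inv_atTop_zero.comp hsqrt
  have hratio : Tendsto (fun k => (n k : ℝ) / lam k) atTop (𝓝 1) := by
    have h1 := (h.mul hinv).add_const 1
    rw [mul_zero, zero_add] at h1
    refine h1.congr' ?_
    filter_upwards [hpos] with k hk
    rw [← div_eq_mul_inv, div_div, Real.mul_self_sqrt hk.le]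
    field_simp
    ring
  have hratio' : Tendsto (fun k => lam k / (n k : ℝ)) atTop (𝓝 1) := by
    have h1 := hratio.inv₀ one_ne_zero
    rw [inv_one] at h1
    exact h1.congr fun k => inv_div _ _
  have hnR : Tendsto (fun k => (n k : ℝ)) atTop atTop := by
    refine (hlam.atTop_mul_pos one_pos hratio).congr' ?_
    filter_upwards [hpos] with k hk
    field_simp
  have hn : Tendsto n atTop atTop := tendsto_natCast_atTop_iff.1 hnR
  have hnpos : ∀ᶠ k in atTop, 0 < (n k : ℝ) := hnR.eventually_gt_atTop 0
  -- with `x = (n - lam) / n`, the exponent `n * log (lam / n) + n - lam` is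
  -- `n * (log (1 - x) + x)`, which is `-n * x ^ 2 / 2` up to a cubic error
  set x : ℕ → ℝ := fun k => ((n k : ℝ) - lam k) / n k with hx
  have hnx : Tendsto (fun k => (n k : ℝ) * x k ^ 2) atTop (𝓝 (ζ ^ 2)) := by
    have h1 := (h.pow 2).mul hratio'
    rw [mul_one] at h1
    refine h1.congr' ?_
    filter_upwards [hpos, hnpos] with k hk hk'
    rw [hx, div_pow, div_pow, Real.sq_sqrt hk.le]
    field_simp
  have hx0 : Tendsto x atTop (𝓝 0) := by
    have h1 := (tendsto_const_nhds (x := (1 : ℝ))).sub hratio'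
    rw [sub_self] at h1
    refine h1.congr' ?_
    filter_upwards [hnpos] with k hk
    rw [hx]
    field_simp
  have hexp : Tendsto (fun k => (n k : ℝ) * (Real.log (1 - x k) + x k)) atTop
      (𝓝 (-ζ ^ 2 / 2)) := by
    have h1 : Tendsto (fun k => (n k : ℝ) * x k ^ 2 * (|x k| / (1 - |x k|))) atTop (𝓝 0) := by
      have h2 : Tendsto (fun k => |x k|) atTop (𝓝 0) := by simpa using hx0.abs
      have h3 := hnx.mul (h2.div (h2.const_sub 1) (by norm_num))
      simpa using h3
    have h4 : Tendsto (fun k => (n k : ℝ) * (x k + x k ^ 2 / 2 + Real.log (1 - x k))) atTop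
        (𝓝 0) := by
      refine squeeze_zero_norm' ?_ h1
      have hlt : ∀ᶠ k in atTop, |x k| < 1 := by
        have h2 : Tendsto (fun k => |x k|) atTop (𝓝 0) := by simpa using hx0.abs
        exact h2.eventually_lt_const one_pos
      filter_upwards [hlt] with k hk
      have h5 := Real.abs_log_sub_add_sum_range_le hk 2
      simp only [Finset.sum_range_succ, Finset.sum_range_zero, zero_add, pow_one, Nat.cast_zero,
        Nat.cast_one, div_one, one_add_one_eq_two] at h5
      rw [Real.norm_eq_abs, abs_mul, Nat.abs_cast]
      refine (mul_le_mul_of_nonneg_left h5 (Nat.cast_nonneg _)).trans (le_of_eq ?_)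
      rw [← sq_abs (x k)]
      ring
    have h6 := h4.sub (hnx.div_const 2)
    have h7 : -ζ ^ 2 / 2 = 0 - ζ ^ 2 / 2 := by ring
    rw [h7]
    refine h6.congr fun k => ?_
    ring
  have hst : Tendsto (fun k => √Real.pi / Stirling.stirlingSeq (n k)) atTop (𝓝 1) := by
    have h1 := (tendsto_const_nhds (x := √Real.pi)).div
      (Stirling.tendsto_stirlingSeq_sqrt_pi.comp hn) (by positivity)
    rwa [div_self (by positivity)] at h1
  have hall := (hst.mul hratio'.sqrt).mul ((Real.continuous_exp.tendsto _).comp hexp)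
  rw [Real.sqrt_one, one_mul, one_mul] at hall
  refine hall.congr' ?_
  filter_upwards [hpos, hnpos] with k hk hk'
  have h1 : 1 - x k = lam k / n k := by
    rw [hx]
    field_simp
    ring
  have h2 : Real.exp ((n k : ℝ) * (Real.log (1 - x k) + x k))
      = lam k ^ n k * Real.exp (-lam k) / (n k / Real.exp 1) ^ n k := by
    rw [h1, mul_add, Real.exp_add, Real.exp_nat_mul, Real.exp_log (by positivity), hx,
      mul_div_cancel₀ _ hk'.ne', sub_eq_add_neg, Real.exp_add, div_pow, div_pow,
      ← Real.exp_nat_mul, mul_one]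
    field_simp
  rw [Function.comp_apply, h2, poissonDensity_natCast, Stirling.stirlingSeq, Real.sqrt_div hk.le,
    mul_assoc 2 Real.pi, Real.sqrt_mul zero_le_two (Real.pi * lam k),
    Real.sqrt_mul Real.pi_pos.le, Real.sqrt_mul zero_le_two (n k : ℝ)]
  field_simp

/-- The local central limit theorem for Poisson variables, at a real argument. -/
theorem tendsto_poissonDensity {lam x K : ℕ → ℝ} {w z : ℝ} (hw : 0 < w)
    (hK : Tendsto K atTop atTop) (hlam : Tendsto (fun k => lam k / K k) atTop (𝓝 w))
    (h : Tendsto (fun k => (x k - lam k) / √(K k)) atTop (𝓝 z)) :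
    Tendsto (fun k => poissonDensity (lam k) (x k)) atTop (𝓝 (Real.exp (-(z ^ 2 / w) / 2))) := by
  have hKpos : ∀ᶠ k in atTop, 0 < K k := hK.eventually_gt_atTop 0
  have hlamtop : Tendsto lam atTop atTop := by
    refine (hK.atTop_mul_pos hw hlam).congr' ?_
    filter_upwards [hKpos] with k hk
    field_simp
  have hpos : ∀ᶠ k in atTop, 0 < lam k := hlamtop.eventually_gt_atTop 0
  have hsqrt : Tendsto (fun k => √(lam k)) atTop atTop := Real.tendsto_sqrt_atTop.comp hlamtop
  have h1 : Tendsto (fun k => (x k - lam k) / √(lam k)) atTop (𝓝 (z / √w)) := by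
    refine (h.div hlam.sqrt (by positivity)).congr' ?_
    filter_upwards [hKpos, hpos] with k hk hk'
    rw [Pi.div_apply, Real.sqrt_div hk'.le]
    field_simp
  have hx : ∀ᶠ k in atTop, 0 ≤ x k := by
    have h2 := hsqrt.atTop_add h1
    filter_upwards [hpos, h2.eventually_ge_atTop 0] with k hk hk'
    have h3 : x k = √(lam k) * (√(lam k) + (x k - lam k) / √(lam k)) := by
      rw [mul_add, Real.mul_self_sqrt hk.le]
      field_simp
      ring
    rw [h3]
    positivity
  have h4 : Tendsto (fun k => ((⌊x k⌋₊ : ℝ) - x k) / √(lam k)) atTop (𝓝 0) := by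
    refine squeeze_zero_norm' ?_ (tendsto_inv_atTop_zero.comp hsqrt)
    filter_upwards [hx] with k hk
    rw [Real.norm_eq_abs, abs_div, abs_of_nonneg (Real.sqrt_nonneg _), div_eq_mul_inv]
    exact mul_le_of_le_one_left (by positivity) (abs_floor_sub_le hk)
  have h5 : Tendsto (fun k => ((⌊x k⌋₊ : ℝ) - lam k) / √(lam k)) atTop (𝓝 (z / √w)) := by
    have h6 := h4.add h1
    rw [zero_add] at h6
    refine h6.congr fun k => ?_
    ring
  have h7 := tendsto_poissonDensity_natCast hlamtop h5
  rw [div_pow, Real.sq_sqrt hw.le] at h7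
  refine h7.congr' ?_
  filter_upwards [hx] with k hk
  rw [poissonDensity_natCast, poissonDensity, if_pos hk]

end Poisson

/-! ### Riemann sums over lattices -/

section RiemannSum

variable {E : Type*} [NormedAddCommGroup E] [NormedSpace ℝ E] [FiniteDimensional ℝ E]
  [MeasurableSpace E] [BorelSpace E] (μ : Measure E) [μ.IsAddHaarMeasure]

theorem integrable_exp_neg_mul_norm {c : ℝ} (hc : 0 < c) :
    Integrable (fun x : E => Real.exp (-(c * ‖x‖))) μ := by
  set r : ℕ := Module.finrank ℝ E + 1 with hr
  have h1 : Integrable (fun x : E => (1 + ‖x‖) ^ (-(r : ℝ))) μ :=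
    integrable_one_add_norm (by rw [hr]; push_cast; linarith)
  refine (h1.const_mul (Real.exp c * (r.factorial / c ^ r))).mono'
    (by fun_prop) (Eventually.of_forall fun x => ?_)
  have hx : 0 < 1 + ‖x‖ := by positivity
  rw [Real.norm_eq_abs, Real.abs_exp, Real.rpow_neg hx.le, Real.rpow_natCast]
  have h2 := Real.pow_div_factorial_le_exp (c * (1 + ‖x‖)) (by positivity) r
  rw [div_le_iff₀ (by positivity), mul_pow] at h2
  have h3 : Real.exp (-(c * ‖x‖)) = Real.exp c * (Real.exp (c * (1 + ‖x‖)))⁻¹ := by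
    rw [← Real.exp_neg, ← Real.exp_add]
    ring_nf
  rw [h3, mul_assoc]
  refine mul_le_mul_of_nonneg_left ?_ (Real.exp_pos _).le
  rw [← div_eq_mul_inv, div_div, inv_le_comm₀ (Real.exp_pos _) (by positivity), inv_div,
    div_le_iff₀ (by positivity)]
  exact h2

variable {ι : Type*} [Fintype ι] (b : Module.Basis ι ℝ E)

omit [FiniteDimensional ℝ E] [MeasurableSpace E] [BorelSpace E] in
theorem floor_eq_iff_sub_mem (x : E) (l : Submodule.span ℤ (Set.range b)) :
    ZSpan.floor b x = l ↔ x - l ∈ ZSpan.fundamentalDomain b := by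
  constructor
  · rintro rfl
    exact ZSpan.fract_mem_fundamentalDomain b x
  · intro h
    have h1 := ZSpan.fract_eq_self.2 h
    rw [sub_eq_add_neg, ZSpan.fract_add_ZSpan b x (Submodule.neg_mem _ l.2), ← sub_eq_add_neg,
      ZSpan.fract_apply] at h1
    exact Subtype.ext (sub_right_injective h1)

theorem measurable_coe_floor : Measurable fun x : E => (ZSpan.floor b x : E) := by
  have h : (fun x : E => (ZSpan.floor b x : E)) = fun x => ∑ i, (⌊b.repr x i⌋ : ℝ) • b i := by
    funext x
    conv_lhs => rw [← b.sum_repr (ZSpan.floor b x : E)]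
    simp only [ZSpan.repr_floor_apply]
  rw [h]
  refine Finset.measurable_sum _ fun i _ => ?_
  have h1 : Measurable fun x => b.repr x i :=
    (LinearMap.continuous_of_finiteDimensional (b.coord i)).measurable
  have h2 : Measurable fun x => (⌊b.repr x i⌋ : ℝ) :=
    (measurable_from_top (f := fun n : ℤ => (n : ℝ))).comp (Int.measurable_floor.comp h1)
  exact h2.smul_const (b i)

/-- The integral of a function that is constant on the cells of a lattice. -/
theorem integral_comp_floor {f : E → ℝ} (S : Finset (Submodule.span ℤ (Set.range b)))
    (hS : ∀ l : Submodule.span ℤ (Set.range b), l ∉ S → f l = 0) :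
    ∫ x, f (ZSpan.floor b x) ∂μ = μ.real (ZSpan.fundamentalDomain b) * ∑ l ∈ S, f l := by
  classical
  have hset : ∀ l : Submodule.span ℤ (Set.range b),
      {x | ZSpan.floor b x = l} = (fun x => x - (l : E)) ⁻¹' ZSpan.fundamentalDomain b := by
    intro l
    ext x
    exact floor_eq_iff_sub_mem b x l
  have hmeas : ∀ l : Submodule.span ℤ (Set.range b), MeasurableSet {x | ZSpan.floor b x = l} := by
    intro l
    rw [hset]
    exact (measurable_sub_const _) (ZSpan.fundamentalDomain_measurableSet b)
  have hvol : ∀ l : Submodule.span ℤ (Set.range b),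
      μ {x | ZSpan.floor b x = l} = μ (ZSpan.fundamentalDomain b) := by
    intro l
    rw [hset]
    simp only [sub_eq_add_neg]
    exact measure_preimage_add_right μ _ _
  have hfin : μ (ZSpan.fundamentalDomain b) ≠ ⊤ :=
    (ZSpan.fundamentalDomain_isBounded b).measure_lt_top.ne
  have h1 : (fun x => f (ZSpan.floor b x))
      = fun x => ∑ l ∈ S, Set.indicator {x | ZSpan.floor b x = l} (fun _ => f l) x := by
    funext x
    simp only [Set.indicator_apply, Set.mem_ofPred_eq]
    by_cases hx : ZSpan.floor b x ∈ S
    · rw [Finset.sum_ite_eq, if_pos hx]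
    · rw [Finset.sum_ite_eq, if_neg hx, hS _ hx]
  rw [h1, integral_finsetSum, Finset.mul_sum]
  · refine Finset.sum_congr rfl fun l _ => ?_
    rw [integral_indicator_const _ (hmeas l), measureReal_def, hvol, ← measureReal_def, smul_eq_mul]
  · intro l _
    refine (integrable_indicator_iff (hmeas l)).2 (integrableOn_const ?_)
    rw [hvol]
    exact hfin

/-- Riemann sums over shifted and rescaled lattices. The sum is the integral of a function that is
constant on small cells, so that the limit follows by dominated convergence. -/
theorem tendsto_lattice_sum {R : ℕ → ℝ} (hR : Tendsto R atTop atTop) (a : ℕ → E)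
    (S : ℕ → Finset (Submodule.span ℤ (Set.range b))) {g : ℕ → E → ℝ} {G : E → ℝ}
    (hg : ∀ k, Measurable (g k)) {A c : ℝ} (hA : 0 ≤ A) (hc : 0 < c)
    (hbound : ∀ᶠ k in atTop, ∀ x, |g k x| ≤ A * Real.exp (-(c * ‖x‖)))
    (hsupp : ∀ᶠ k in atTop, ∀ l : Submodule.span ℤ (Set.range b), l ∉ S k →
      g k ((R k)⁻¹ • ((l : E) + a k)) = 0)
    (hlim : ∀ (x : ℕ → E) (y : E), Tendsto x atTop (𝓝 y) →
      Tendsto (fun k => g k (x k)) atTop (𝓝 (G y))) :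
    Tendsto (fun k => |(R k ^ Module.finrank ℝ E)⁻¹| * (μ.real (ZSpan.fundamentalDomain b) *
      ∑ l ∈ S k, g k ((R k)⁻¹ • ((l : E) + a k)))) atTop (𝓝 (∫ x, G x ∂μ)) := by
  set M : ℝ := ∑ i, ‖b i‖ with hM
  let y : ℕ → E → E := fun k x => (R k)⁻¹ • ((ZSpan.floor b (R k • x - a k) : E) + a k)
  have hy : ∀ᶠ k in atTop, ∀ x, ‖y k x - x‖ ≤ (R k)⁻¹ * M := by
    filter_upwards [hR.eventually_gt_atTop 0] with k hk x
    have h1 : y k x - x = -((R k)⁻¹ • ZSpan.fract b (R k • x - a k)) := by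
      simp only [ZSpan.fract_apply, y, smul_add, smul_sub, inv_smul_smul₀ hk.ne']
      abel
    rw [h1, norm_neg, norm_smul, Real.norm_eq_abs, abs_of_pos (inv_pos.2 hk)]
    exact mul_le_mul_of_nonneg_left (ZSpan.norm_fract_le b _) (inv_pos.2 hk).le
  have hyt : ∀ x, Tendsto (fun k => y k x) atTop (𝓝 x) := by
    intro x
    rw [tendsto_iff_norm_sub_tendsto_zero]
    have h1 : Tendsto (fun k => (R k)⁻¹ * M) atTop (𝓝 0) := by
      simpa using (tendsto_inv_atTop_zero.comp hR).mul_const M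
    refine squeeze_zero' (Eventually.of_forall fun k => norm_nonneg _) ?_ h1
    filter_upwards [hy] with k hk using hk x
  have hym : ∀ k, Measurable (y k) := fun k =>
    (((measurable_coe_floor b).comp ((measurable_id.const_smul (R k)).sub_const (a k))).add_const
      (a k)).const_smul _
  have hmain : Tendsto (fun k => ∫ x, g k (y k x) ∂μ) atTop (𝓝 (∫ x, G x ∂μ)) := by
    refine tendsto_integral_filter_of_dominated_convergence
      (fun x => A * Real.exp (c * M) * Real.exp (-(c * ‖x‖))) ?_ ?_ ?_ ?_
    · exact Eventually.of_forall fun k => ((hg k).comp (hym k)).aestronglyMeasurable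
    · filter_upwards [hbound, hy, hR.eventually_ge_atTop 1] with k h1 h2 h3
      refine Eventually.of_forall fun x => (h1 _).trans ?_
      rw [mul_assoc, ← Real.exp_add]
      refine mul_le_mul_of_nonneg_left (Real.exp_le_exp.2 ?_) hA
      have h4 : (R k)⁻¹ * M ≤ M := mul_le_of_le_one_left
        (Finset.sum_nonneg fun i _ => norm_nonneg _) (inv_le_one_of_one_le₀ h3)
      have h5 : ‖x‖ ≤ ‖y k x‖ + ‖y k x - x‖ := by
        have := norm_sub_le (y k x) (y k x - x)
        rwa [sub_sub_cancel] at this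
      have h6 : ‖x‖ ≤ ‖y k x‖ + M := by linarith [h2 x]
      nlinarith [mul_le_mul_of_nonneg_left h6 hc.le]
    · exact (integrable_exp_neg_mul_norm μ hc).const_mul _
    · exact Eventually.of_forall fun x => hlim _ _ (hyt x)
  refine hmain.congr' ?_
  filter_upwards [hsupp] with k hk
  refine (Measure.integral_comp_smul μ
    (fun z => g k ((R k)⁻¹ • ((ZSpan.floor b (z - a k) : E) + a k))) (R k)).trans ?_
  rw [smul_eq_mul]
  congr 1
  rw [integral_sub_right_eq_self (fun z => g k ((R k)⁻¹ • ((ZSpan.floor b z : E) + a k))) (a k)]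
  exact integral_comp_floor μ b (f := fun z => g k ((R k)⁻¹ • (z + a k))) (S k) hk

end RiemannSum

/-! ### The limiting Gaussian measure and the fluctuation space -/

section Gaussian

open scoped RealInnerProductSpace

/-- The standard Gaussian measure has density proportional to `exp (-‖y‖ ^ 2 / 2)` with respect to
a Haar measure. -/
theorem exists_haar_integral_stdGaussian (E : Type*) [NormedAddCommGroup E]
    [InnerProductSpace ℝ E] [FiniteDimensional ℝ E] [MeasurableSpace E] [BorelSpace E] :
    ∃ μ : Measure E, μ.IsAddHaarMeasure ∧ 0 < ∫ y, Real.exp (-‖y‖ ^ 2 / 2) ∂μ ∧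
      ∀ f : E → ℝ, ∫ y, f y ∂(stdGaussian E)
        = (∫ y, f y * Real.exp (-‖y‖ ^ 2 / 2) ∂μ) / ∫ y, Real.exp (-‖y‖ ^ 2 / 2) ∂μ := by
  set ρ : E → ℝ := fun y => Real.exp (-‖y‖ ^ 2 / 2) with hρ
  set Z : ℝ := ∫ y, ρ y with hZ
  have hρm : Measurable ρ := by fun_prop
  have hb : (0 : ℝ) < ((1 / 2 : ℂ)).re := by norm_num
  have hZC : (Z : ℂ) = (Real.pi / (1 / 2) : ℂ) ^ (Module.finrank ℝ E / 2 : ℂ) := by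
    rw [hZ, ← integral_complex_ofReal, ← GaussianFourier.integral_cexp_neg_mul_sq_norm hb]
    refine integral_congr_ae (Eventually.of_forall fun y => ?_)
    simp only [hρ]
    push_cast
    ring_nf
  have hZ0 : 0 < Z := by
    have h1 := GaussianFourier.integral_rexp_neg_mul_sq_norm (V := E) (b := 1 / 2) (by norm_num)
    have h2 : Z = (Real.pi / (1 / 2)) ^ (Module.finrank ℝ E / 2 : ℝ) := by
      rw [hZ, ← h1]
      refine integral_congr_ae (Eventually.of_forall fun y => ?_)
      simp only [hρ]
      ring_nf
    rw [h2]
    have := Real.pi_pos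
    positivity
  have hρi : Integrable ρ := by
    by_contra h
    exact hZ0.ne' (integral_undef h)
  set d : E → ENNReal := fun y => ENNReal.ofReal (ρ y / Z) with hd
  have hdm : Measurable d := (hρm.div_const Z).ennreal_ofReal
  have hd0 : ∀ y, 0 ≤ ρ y / Z := fun y => div_nonneg (Real.exp_pos _).le hZ0.le
  have hprob : IsProbabilityMeasure ((volume : Measure E).withDensity d) := by
    constructor
    rw [withDensity_apply _ MeasurableSet.univ, setLIntegral_univ,
      ← ofReal_integral_eq_lintegral_ofReal (hρi.div_const Z) (Eventually.of_forall hd0),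
      integral_div, ← hZ, div_self hZ0.ne', ENNReal.ofReal_one]
  have hstd : (volume : Measure E).withDensity d = stdGaussian E := by
    refine Measure.ext_of_charFun (funext fun t => ?_)
    rw [charFun_stdGaussian, charFun_apply, integral_withDensity_eq_integral_toReal_smul hdm
      (Eventually.of_forall fun y => ENNReal.ofReal_lt_top)]
    have h1 : ∀ y : E, (d y).toReal • Complex.exp (⟪y, t⟫ * Complex.I)
        = (Z : ℂ)⁻¹ * Complex.exp (-(1 / 2 : ℂ) * ‖y‖ ^ 2 + Complex.I * ⟪t, y⟫) := by
      intro y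
      rw [hd, ENNReal.toReal_ofReal (hd0 y), Complex.real_smul, real_inner_comm, Complex.exp_add]
      simp only [hρ]
      push_cast
      ring_nf
    simp_rw [h1]
    have hZ0' : (Z : ℂ) ≠ 0 := by exact_mod_cast hZ0.ne'
    rw [integral_const_mul, GaussianFourier.integral_cexp_neg_mul_sq_norm_add hb, ← hZC,
      ← mul_assoc, inv_mul_cancel₀ hZ0', one_mul, Complex.I_sq]
    congr 1
    ring
  refine ⟨volume, inferInstance, hZ0, fun f => ?_⟩
  rw [← hstd, integral_withDensity_eq_integral_toReal_smul hdm
      (Eventually.of_forall fun y => ENNReal.ofReal_lt_top), ← integral_div]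
  refine integral_congr_ae (Eventually.of_forall fun y => ?_)
  simp only [hd, ENNReal.toReal_ofReal (hd0 y), smul_eq_mul]
  ring

/-- A linear image of a standard Gaussian measure, identified by its characteristic function. The
vector `p` is the image of `ξ` under the adjoint of `A`. -/
theorem map_stdGaussian_eq_multivariateGaussian {E : Type*} [NormedAddCommGroup E]
    [InnerProductSpace ℝ E] [FiniteDimensional ℝ E] [MeasurableSpace E] [BorelSpace E]
    {ι : Type*} [Fintype ι] [DecidableEq ι] (A : E →L[ℝ] EuclideanSpace ℝ ι)
    {S : Matrix ι ι ℝ} (hS : S.PosSemidef)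
    (h : ∀ ξ : EuclideanSpace ℝ ι, ∃ p : E, (∀ y, ⟪A y, ξ⟫ = ⟪y, p⟫) ∧
      ‖p‖ ^ 2 = (ξ : ι → ℝ) ⬝ᵥ S.mulVec ξ) :
    (stdGaussian E).map A = multivariateGaussian 0 S := by
  have : IsProbabilityMeasure ((stdGaussian E).map A) :=
    Measure.isProbabilityMeasure_map A.continuous.measurable.aemeasurable
  refine Measure.ext_of_charFun (funext fun ξ => ?_)
  obtain ⟨p, hp, hn⟩ := h ξ
  rw [charFun_multivariateGaussian hS, ← hn, charFun_apply,
    integral_map A.continuous.measurable.aemeasurable (by fun_prop)]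
  simp_rw [hp]
  rw [← charFun_apply, charFun_stdGaussian]
  congr 1
  simp
  ring

end Gaussian

section FluctuationSpace

open scoped RealInnerProductSpace

variable {V : Type*} {T : Finset (Multiset V)} {c : T → ℝ}

/-- Multiplication of the coordinates by `√c`. -/
def scaleMap (c : T → ℝ) : EuclideanSpace ℝ T →L[ℝ] EuclideanSpace ℝ T :=
  LinearMap.toContinuousLinearMap
    { toFun := fun y => WithLp.toLp 2 fun t => √(c t) * y t
      map_add' := fun x y => by ext t; simp [mul_add]
      map_smul' := fun r y => by ext t; simp [mul_left_comm] }

@[simp]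
theorem scaleMap_apply (c : T → ℝ) (y : EuclideanSpace ℝ T) (t : T) :
    scaleMap c y t = √(c t) * y t := rfl

variable [DecidableEq V]

/-- The kernel of `D`, in coordinates divided by `√c`. In these coordinates the quadratic form
`∑ t, z t ^ 2 / c t` becomes the squared euclidean norm. -/
def fluctSpace (T : Finset (Multiset V)) (c : T → ℝ) : Submodule ℝ (EuclideanSpace ℝ T) :=
  LinearMap.ker ((incidence T).mulVecLin ∘ₗ
    (WithLp.linearEquiv 2 ℝ (T → ℝ)).toLinearMap ∘ₗ (scaleMap c).toLinearMap)

theorem mem_fluctSpace {y : EuclideanSpace ℝ T} : y ∈ fluctSpace T c ↔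
    (incidence T).mulVec (fun t => √(c t) * y t) = 0 := Iff.rfl

/-- A real vector in the kernel of `D` is a linear combination of integer vectors in the kernel of
`D`: expand its entries in a basis of `ℝ` over `ℚ`. -/
theorem exists_sum_int_ker {z : T → ℝ} (hz : (incidence T).mulVec z = 0) :
    ∃ (s : Finset (Module.Basis.ofVectorSpaceIndex ℚ ℝ))
      (r : Module.Basis.ofVectorSpaceIndex ℚ ℝ → ℝ)
      (q : Module.Basis.ofVectorSpaceIndex ℚ ℝ → T → ℤ),
      (∀ j, (incidence T).mulVec (fun t => (q j t : ℝ)) = 0) ∧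
      ∀ t, z t = ∑ j ∈ s, r j * q j t := by
  classical
  set B := Module.Basis.ofVectorSpace ℚ ℝ with hB
  have hq : ∀ j, ∀ v, ∑ t : T, (t.1.count v : ℚ) * B.repr (z t) j = 0 := by
    intro j v
    have h1 : (incidence T).mulVec z v = 0 := congrFun hz v
    have h2 : ∑ t : T, (t.1.count v : ℚ) • z t = 0 := by
      rw [← h1, incidence_mulVec_apply]
      refine Finset.sum_congr rfl fun t _ => ?_
      rw [Rat.smul_def, mul_comm]
      norm_cast
    have h3 := congrArg (B.coord j) h2
    rw [map_sum, map_zero] at h3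
    rw [← h3]
    refine Finset.sum_congr rfl fun t _ => ?_
    rw [map_smul, smul_eq_mul, Module.Basis.coord_apply]
  -- a common denominator of the coordinates with index `j`
  let d : Module.Basis.ofVectorSpaceIndex ℚ ℝ → ℕ := fun j => ∏ t, (B.repr (z t) j).den
  have hd0 : ∀ j, (d j : ℚ) ≠ 0 := fun j =>
    Nat.cast_ne_zero.2 (Finset.prod_ne_zero_iff.2 fun t _ => (B.repr (z t) j).den_ne_zero)
  have hint : ∀ j t, ∃ n : ℤ, (n : ℚ) = d j * B.repr (z t) j := by
    intro j t
    obtain ⟨e, he⟩ : (B.repr (z t) j).den ∣ d j := Finset.dvd_prod_of_mem _ (Finset.mem_univ t)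
    refine ⟨e * (B.repr (z t) j).num, ?_⟩
    rw [he]
    push_cast
    rw [mul_comm ((B.repr (z t) j).den : ℚ), mul_assoc, Rat.den_mul_eq_num]
  choose q hqd using hint
  refine ⟨Finset.univ.biUnion fun t => (B.repr (z t)).support, fun j => B j / d j, q, ?_, ?_⟩
  · intro j
    funext v
    rw [incidence_mulVec_apply]
    have h1 : ∑ t : T, (q j t : ℚ) * (t.1.count v : ℚ) = 0 := by
      simp_rw [hqd]
      rw [← mul_zero (d j : ℚ), ← hq j v, Finset.mul_sum]
      exact Finset.sum_congr rfl fun t _ => by ring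
    rw [Pi.zero_apply]
    exact_mod_cast congrArg (fun x : ℚ => (x : ℝ)) h1
  · intro t
    have h1 : z t = ∑ j ∈ Finset.univ.biUnion fun t => (B.repr (z t)).support,
        B.repr (z t) j • B j := by
      conv_lhs => rw [← B.linearCombination_repr (z t), Finsupp.linearCombination_apply]
      exact Finsupp.sum_of_support_subset _
        (Finset.subset_biUnion_of_mem (fun t => (B.repr (z t)).support) (Finset.mem_univ t)) _
        (by simp)
    rw [h1]
    refine Finset.sum_congr rfl fun j _ => ?_
    have h2 : (q j t : ℝ) = d j * (B.repr (z t) j : ℝ) := by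
      exact_mod_cast congrArg (fun x : ℚ => (x : ℝ)) (hqd j t)
    have h3 : (d j : ℝ) ≠ 0 := by exact_mod_cast hd0 j
    rw [h2, Rat.smul_def]
    field_simp

/-- The vectors of the fluctuation space that come from integer vectors in the kernel of `D` form a
lattice. -/
theorem exists_basis_fluctSpace (hc : ∀ t, 0 < c t) :
    ∃ (n : ℕ) (b : Module.Basis (Fin n) ℝ (fluctSpace T c)),
      ∀ y : fluctSpace T c, y ∈ Submodule.span ℤ (Set.range b) ↔
        ∀ t, ∃ n : ℤ, (n : ℝ) = √(c t) * (y : EuclideanSpace ℝ T) t := by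
  have hs : ∀ t, √(c t) ≠ 0 := fun t => (Real.sqrt_pos.2 (hc t)).ne'
  let e : fluctSpace T c →ₗ[ℝ] (T → ℝ) := (WithLp.linearEquiv 2 ℝ (T → ℝ)).toLinearMap ∘ₗ
    (scaleMap c).toLinearMap ∘ₗ (fluctSpace T c).subtype
  have he : ∀ y t, e y t = √(c t) * (y : EuclideanSpace ℝ T) t := fun _ _ => rfl
  have hinj : Function.Injective e := by
    intro x y hxy
    refine Subtype.ext (PiLp.ext fun t => ?_)
    exact mul_left_cancel₀ (hs t) (congrFun hxy t)
  have hcont : Continuous e := e.continuous_of_finiteDimensional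
  let L : Submodule ℤ (fluctSpace T c) :=
    ZLattice.comap ℝ (Submodule.span ℤ (Set.range (Pi.basisFun ℝ T))) e
  have hL : ∀ y, y ∈ L ↔ ∀ t, ∃ n : ℤ, (n : ℝ) = √(c t) * (y : EuclideanSpace ℝ T) t := by
    intro y
    change e y ∈ Submodule.span ℤ (Set.range (Pi.basisFun ℝ T)) ↔ _
    rw [Module.Basis.mem_span_iff_repr_mem]
    simp [he]
  have hdisc : DiscreteTopology L := ZLattice.comap_discreteTopology ℝ _ hcont hinj
  have hspan : IsZLattice ℝ L := by
    refine ⟨eq_top_iff.2 fun y _ => ?_⟩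
    obtain ⟨s, r, q, hq, hz⟩ := exists_sum_int_ker (mem_fluctSpace.1 y.2)
    have hmem : ∀ j, (WithLp.toLp 2 fun t => (q j t : ℝ) / √(c t)) ∈ fluctSpace T c := by
      intro j
      rw [mem_fluctSpace, ← hq j]
      congr 1
      funext t
      exact mul_div_cancel₀ _ (hs t)
    have hy : y = ∑ j ∈ s, r j • (⟨_, hmem j⟩ : fluctSpace T c) := by
      apply hinj
      funext t
      rw [map_sum, Finset.sum_apply, he, hz]
      refine Finset.sum_congr rfl fun j _ => ?_
      rw [map_smul, Pi.smul_apply, he, smul_eq_mul]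
      congr 1
      exact (mul_div_cancel₀ _ (hs t)).symm
    rw [hy]
    refine Submodule.sum_mem _ fun j _ => Submodule.smul_mem _ _ (Submodule.subset_span ?_)
    refine (hL _).2 fun t => ⟨q j t, ?_⟩
    exact (mul_div_cancel₀ _ (hs t)).symm
  refine ⟨_, (Module.finBasis ℤ L).ofZLatticeBasis ℝ L, fun y => ?_⟩
  rw [Module.Basis.ofZLatticeBasis_span]
  exact hL y

/-- The standard Gaussian measure of the fluctuation space corresponds to the Gaussian measure with
covariance `w_s (I - C 𝕂)_{t,s}`. -/
theorem map_stdGaussian_fluctSpace [Fintype V] (hc : ∀ t, 0 < c t) :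
    (stdGaussian (fluctSpace T c)).map ((scaleMap c).comp (fluctSpace T c).subtypeL)
      = multivariateGaussian 0 (covMatrix T c) := by
  have hs : ∀ t, √(c t) ≠ 0 := fun t => (Real.sqrt_pos.2 (hc t)).ne'
  refine map_stdGaussian_eq_multivariateGaussian _ (posSemidef_covMatrix hc) fun ξ => ?_
  set P : T → ℝ := (complProjection T c).mulVec (fun t => c t * ξ t) with hP
  have hmem : (WithLp.toLp 2 fun t => P t / √(c t)) ∈ fluctSpace T c := by
    rw [mem_fluctSpace, ← incidence_complProjection hc (fun t => c t * ξ t)]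
    congr 1
    funext t
    exact mul_div_cancel₀ _ (hs t)
  refine ⟨⟨_, hmem⟩, fun y => ?_, ?_⟩
  · -- the difference of `C ξ` and its projection lies in `C Im D*`, which is orthogonal to `ker D`
    obtain ⟨u, h1, -⟩ := exists_kernelMatrix_mulVec hc (fun t => c t * ξ t)
    have h2 : ∑ t, √(c t) * (y : EuclideanSpace ℝ T) t * (incidence T).transpose.mulVec u t = 0 := by
      change (fun t => √(c t) * (y : EuclideanSpace ℝ T) t) ⬝ᵥ
        (incidence T).transpose.mulVec u = 0
      rw [Matrix.mulVec_transpose, dotProduct_comm, ← Matrix.dotProduct_mulVec,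
        mem_fluctSpace.1 y.2, dotProduct_zero]
    rw [Submodule.coe_inner, PiLp.inner_apply, PiLp.inner_apply, ← sub_eq_zero, ← h2,
      ← Finset.sum_sub_distrib]
    refine Finset.sum_congr rfl fun t _ => ?_
    have h3 : P t = c t * ξ t - c t * (incidence T).transpose.mulVec u t := by
      rw [hP, complProjection_mulVec, h1]
    have h4 : P t / √(c t) = √(c t) * ξ t - √(c t) * (incidence T).transpose.mulVec u t := by
      rw [h3, div_eq_iff (hs t)]
      linear_combination (-(ξ t - (incidence T).transpose.mulVec u t)) *
        Real.mul_self_sqrt (hc t).le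
    simp only [RCLike.inner_apply, conj_trivial, h4]
    simp
    ring
  · rw [dotProduct_covMatrix_mulVec hc, Submodule.coe_norm, EuclideanSpace.norm_sq_eq]
    refine Finset.sum_congr rfl fun t _ => ?_
    simp only [Real.norm_eq_abs, sq_abs, div_pow, Real.sq_sqrt (hc t).le]
    rw [← hP, sq]

end FluctuationSpace

/-! ### The local limit theorem for the tile counts -/

section LocalLimit

theorem norm_le_sum_abs {ι : Type*} [Fintype ι] (y : EuclideanSpace ℝ ι) :
    ‖y‖ ≤ ∑ i, |y i| := by
  rw [EuclideanSpace.norm_eq]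
  refine Real.sqrt_le_iff.2 ⟨Finset.sum_nonneg fun i _ => abs_nonneg _, ?_⟩
  simp only [Real.norm_eq_abs]
  exact Finset.sum_sq_le_sq_sum_of_nonneg fun i _ => abs_nonneg (y i)

theorem prod_poissonDensity_le {ι : Type*} [Fintype ι] {lam c : ι → ℝ} {K : ℝ}
    (hK : 0 ≤ K) (hc : ∀ t, 0 < c t) (h1 : ∀ t, 1 ≤ lam t) (h2 : ∀ t, lam t ≤ 4 * (K * c t))
    (y : EuclideanSpace ℝ ι) :
    ∏ t, poissonDensity (lam t) (lam t + √K * (√(c t) * y t))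
      ≤ (6 * Real.exp 2) ^ Fintype.card ι * Real.exp (-(1 / 4 * ‖y‖)) := by
  have h3 : ∀ t, poissonDensity (lam t) (lam t + √K * (√(c t) * y t))
      ≤ 6 * Real.exp 2 * Real.exp (-(1 / 4 * |y t|)) := by
    intro t
    refine (poissonDensity_le (h1 t) _).trans
      (mul_le_mul_of_nonneg_left (Real.exp_le_exp.2 ?_) (by positivity))
    have hl : 0 < √(lam t) := Real.sqrt_pos.2 (by linarith [h1 t])
    have h4 : √(lam t) ≤ 2 * (√K * √(c t)) := by
      rw [← Real.sqrt_mul hK]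
      refine Real.sqrt_le_iff.2 ⟨by positivity, ?_⟩
      rw [mul_pow, Real.sq_sqrt (mul_nonneg hK (hc t).le)]
      linarith [h2 t]
    have h5 : |y t| / 2 ≤ |lam t + √K * (√(c t) * y t) - lam t| / √(lam t) := by
      rw [add_sub_cancel_left, abs_mul, abs_mul, abs_of_nonneg (Real.sqrt_nonneg K),
        abs_of_nonneg (Real.sqrt_nonneg (c t)), le_div_iff₀ hl]
      nlinarith [mul_le_mul_of_nonneg_left h4 (abs_nonneg (y t))]
    linarith
  refine (Finset.prod_le_prod (fun t _ => poissonDensity_nonneg (by linarith [h1 t]) _)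
    fun t _ => h3 t).trans ?_
  rw [Finset.prod_mul_distrib, Finset.prod_const, Finset.card_univ, ← Real.exp_sum]
  refine mul_le_mul_of_nonneg_left (Real.exp_le_exp.2 ?_) (by positivity)
  rw [Finset.sum_neg_distrib, ← Finset.mul_sum]
  linarith [norm_le_sum_abs y]

theorem one_add_norm_sq_le {E F : Type*} [NormedAddCommGroup E] [NormedSpace ℝ E]
    [NormedAddCommGroup F] [NormedSpace ℝ F] (L : E →L[ℝ] F) {s : F} (hs : ‖s‖ ≤ 1) (y : E) :
    (1 + ‖L y + s‖) ^ 2 ≤ (2 + 16 * ‖L‖) ^ 2 * Real.exp (1 / 8 * ‖y‖) := by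
  have h1 : 1 + ‖L y + s‖ ≤ (2 + 16 * ‖L‖) * Real.exp (‖y‖ / 16) := by
    have h2 := Real.add_one_le_exp (‖y‖ / 16)
    have h3 := L.le_opNorm y
    have h4 := norm_add_le (L y) s
    have h5 := mul_le_mul_of_nonneg_left h2 (by positivity : 0 ≤ 2 + 16 * ‖L‖)
    have h6 : (2 + 16 * ‖L‖) * (‖y‖ / 16 + 1) = ‖y‖ / 8 + 2 + ‖L‖ * ‖y‖ + 16 * ‖L‖ := by ring
    have h7 := norm_nonneg y
    have h8 := norm_nonneg L
    linarith
  refine (pow_le_pow_left₀ (by positivity) h1 2).trans (le_of_eq ?_)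
  rw [mul_pow, ← Real.exp_nat_mul]
  congr 2
  push_cast
  ring

variable {V : Type*} {T : Finset (Multiset V)}

theorem prod_poissonDensity_natCast (lam : T → ℝ) (c : T → ℕ) :
    ∏ t, poissonDensity (lam t) (c t)
      = (∏ t, √(2 * Real.pi * lam t) * Real.exp (-lam t)) * poissonWeight lam c := by
  rw [poissonWeight, ← Finset.prod_mul_distrib]
  refine Finset.prod_congr rfl fun t _ => ?_
  rw [poissonDensity_natCast]
  ring

variable [Fintype V] [DecidableEq V]

/-- The local limit theorem: sums of a function of the rescaled counts, weighted with the
conditional Poisson weights and suitably normalised, converge to Gaussian integrals over the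
fluctuation space. The normalisation does not depend on the function. -/
theorem exists_tendsto_sum_poissonWeight (hT : ∀ t ∈ T, t ≠ 0) {N : ℕ → V → ℕ} {K : ℕ → ℕ}
    (hfeas : ∀ k, IsFeasible T (N k)) (hKtop : Tendsto K atTop atTop)
    {wK : ℕ → T → ℝ} {wc : T → ℝ} (hwc : ∀ t, 0 < wc t)
    (hcrit : ∀ᶠ k in atTop, ∀ v, ∑ t : T, wK k t * (t.1.count v : ℝ) = (N k v : ℝ) / K k)
    (hwK : Tendsto wK atTop (𝓝 wc))
    {s : ℕ → EuclideanSpace ℝ T} (hs : Tendsto s atTop (𝓝 0))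
    (μ : Measure (fluctSpace T wc)) [μ.IsAddHaarMeasure] :
    ∃ C : ℕ → ℝ, ∀ (H : EuclideanSpace ℝ T → ℝ) (A : ℝ), Continuous H →
      (∀ z, |H z| ≤ A * (1 + ‖z‖) ^ 2) →
      Tendsto (fun k => C k * ∑ c ∈ countVectors T (N k),
        poissonWeight (fun t => K k * wK k t) c *
          H ((WithLp.toLp 2 fun t => ((c t : ℝ) - K k * wK k t) / √(K k : ℝ)) + s k))
        atTop (𝓝 (∫ y : fluctSpace T wc, H (scaleMap wc y) * Real.exp (-‖y‖ ^ 2 / 2) ∂μ)) := by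
  classical
  have hsq : ∀ t, √(wc t) ≠ 0 := fun t => (Real.sqrt_pos.2 (hwc t)).ne'
  have hKR : Tendsto (fun k => (K k : ℝ)) atTop atTop := tendsto_natCast_atTop_atTop.comp hKtop
  have hR : Tendsto (fun k => √(K k : ℝ)) atTop atTop := Real.tendsto_sqrt_atTop.comp hKR
  obtain ⟨n, b, hb⟩ := exists_basis_fluctSpace (T := T) hwc
  choose c0 hc0 using hfeas
  set lam : ℕ → T → ℝ := fun k t => K k * wK k t with hlam
  have hlamK : ∀ t, Tendsto (fun k => lam k t / K k) atTop (𝓝 (wc t)) := by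
    intro t
    refine (tendsto_pi_nhds.1 hwK t).congr' ?_
    filter_upwards [hKR.eventually_gt_atTop 0] with k hk
    rw [hlam]
    field_simp
  -- the offset of the lattice relative to the centre `lam`; it is arbitrary for the finitely many
  -- `k` at which `K k = 0` or the weights are not critical
  have hex : ∀ k, ∃ a : fluctSpace T wc, (0 < (K k : ℝ) →
      (∀ v, ∑ t : T, wK k t * (t.1.count v : ℝ) = (N k v : ℝ) / K k) →
      ∀ t, √(wc t) * (a : EuclideanSpace ℝ T) t = c0 k t - lam k t) := by
    intro k
    by_cases h : 0 < (K k : ℝ) ∧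
      ∀ v, ∑ t : T, wK k t * (t.1.count v : ℝ) = (N k v : ℝ) / K k
    · refine ⟨⟨WithLp.toLp 2 fun t => (c0 k t - lam k t) / √(wc t), ?_⟩, fun _ _ t =>
        mul_div_cancel₀ _ (hsq t)⟩
      rw [mem_fluctSpace]
      funext v
      rw [incidence_mulVec_apply]
      have h1 : (N k v : ℝ) = ∑ t : T, (c0 k t : ℝ) * (t.1.count v : ℝ) := by
        exact_mod_cast hc0 k v
      have h2 : (N k v : ℝ) = ∑ t : T, lam k t * (t.1.count v : ℝ) := by
        have h3 := h.2 v
        rw [eq_div_iff h.1.ne', Finset.sum_mul] at h3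
        rw [← h3]
        exact Finset.sum_congr rfl fun t _ => by rw [hlam]; ring
      have h4 : ∀ t : T, √(wc t) * ((c0 k t - lam k t) / √(wc t)) = c0 k t - lam k t :=
        fun t => mul_div_cancel₀ _ (hsq t)
      simp only [h4, sub_mul, Finset.sum_sub_distrib]
      rw [← h1, ← h2, sub_self, Pi.zero_apply]
    · exact ⟨0, fun h1 h2 => absurd ⟨h1, h2⟩ h⟩
  choose a ha using hex
  -- the lattice point of a vector of counts
  let pt : ℕ → (T → ℕ) → Submodule.span ℤ (Set.range b) := fun k c =>
    if h : ∃ l : Submodule.span ℤ (Set.range b), ∀ t,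
      √(wc t) * ((l : fluctSpace T wc) : EuclideanSpace ℝ T) t = (c t : ℝ) - c0 k t
    then h.choose else 0
  have hpt : ∀ k, ∀ c ∈ countVectors T (N k), ∀ t,
      √(wc t) * ((pt k c : fluctSpace T wc) : EuclideanSpace ℝ T) t = (c t : ℝ) - c0 k t := by
    intro k c hc
    have h : ∃ l : Submodule.span ℤ (Set.range b), ∀ t,
        √(wc t) * ((l : fluctSpace T wc) : EuclideanSpace ℝ T) t = (c t : ℝ) - c0 k t := by
      have h4 : ∀ t : T, √(wc t) * (((c t : ℝ) - c0 k t) / √(wc t)) = (c t : ℝ) - c0 k t :=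
        fun t => mul_div_cancel₀ _ (hsq t)
      have hmem : (WithLp.toLp 2 fun t => ((c t : ℝ) - c0 k t) / √(wc t)) ∈ fluctSpace T wc := by
        rw [mem_fluctSpace]
        funext v
        have h1 : (N k v : ℝ) = ∑ t : T, (c0 k t : ℝ) * (t.1.count v : ℝ) := by
          exact_mod_cast hc0 k v
        have h2 : (N k v : ℝ) = ∑ t : T, (c t : ℝ) * (t.1.count v : ℝ) := by
          exact_mod_cast (mem_countVectors hT).1 hc v
        rw [incidence_mulVec_apply]
        simp only [h4, sub_mul, Finset.sum_sub_distrib]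
        rw [← h1, ← h2, sub_self, Pi.zero_apply]
      refine ⟨⟨⟨_, hmem⟩, (hb _).2 fun t => ⟨(c t : ℤ) - c0 k t, ?_⟩⟩, h4⟩
      push_cast
      exact (h4 t).symm
    simp only [pt, dif_pos h]
    exact h.choose_spec
  have hinj : ∀ k, Set.InjOn (pt k) (countVectors T (N k)) := by
    intro k c hc c' hc' hcc
    funext t
    have h1 := hpt k c hc t
    rw [hcc, hpt k c' hc' t] at h1
    exact_mod_cast (sub_left_injective h1).symm
  let dens : ℕ → fluctSpace T wc → ℝ := fun k y => ∏ t, poissonDensity (lam k t)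
    (lam k t + √(K k : ℝ) * (√(wc t) * (y : EuclideanSpace ℝ T) t))
  have hcoord : ∀ t : T, Continuous fun y : fluctSpace T wc => (y : EuclideanSpace ℝ T) t :=
    fun t => (EuclideanSpace.proj (𝕜 := ℝ) t).continuous.comp continuous_subtype_val
  have hdensm : ∀ k, Measurable (dens k) := by
    intro k
    refine Finset.measurable_prod _ fun t _ => (measurable_poissonDensity _).comp ?_
    exact (((hcoord t).measurable.const_mul _).const_mul _).const_add _
  -- at a lattice point, the arguments of the densities are integers
  have harg : ∀ k, 0 < (K k : ℝ) →
      (∀ v, ∑ t : T, wK k t * (t.1.count v : ℝ) = (N k v : ℝ) / K k) →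
      ∀ (l : fluctSpace T wc) (t : T), lam k t + √(K k : ℝ) * (√(wc t) *
        (((√(K k : ℝ))⁻¹ • (l + a k) : fluctSpace T wc) : EuclideanSpace ℝ T) t)
        = c0 k t + √(wc t) * (l : EuclideanSpace ℝ T) t := by
    intro k hk hcr l t
    have h1 := ha k hk hcr t
    have h2 : √(K k : ℝ) ≠ 0 := (Real.sqrt_pos.2 hk).ne'
    have h3 : (((√(K k : ℝ))⁻¹ • (l + a k) : fluctSpace T wc) : EuclideanSpace ℝ T) t
        = (√(K k : ℝ))⁻¹ * ((l : EuclideanSpace ℝ T) t + (a k : EuclideanSpace ℝ T) t) := rfl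
    rw [h3, mul_left_comm, mul_inv_cancel_left₀ h2, mul_add, h1]
    ring
  refine ⟨fun k => |(√(K k : ℝ) ^ Module.finrank ℝ (fluctSpace T wc))⁻¹| *
    (μ.real (ZSpan.fundamentalDomain b) *
      ∏ t, √(2 * Real.pi * lam k t) * Real.exp (-lam k t)), fun H A hH hHA => ?_⟩
  have hA0 : 0 ≤ A := by
    have h1 := (abs_nonneg _).trans (hHA 0)
    simpa using h1
  have hlim := tendsto_lattice_sum μ b hR a (fun k => (countVectors T (N k)).image (pt k))
    (g := fun k y => H (scaleMap wc y + s k) * dens k y)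
    (G := fun y => H (scaleMap wc y) * Real.exp (-‖y‖ ^ 2 / 2))
    (A := A * (2 + 16 * ‖(scaleMap wc).comp (fluctSpace T wc).subtypeL‖) ^ 2 *
      (6 * Real.exp 2) ^ Fintype.card T) (c := 1 / 8) ?_ (by positivity) (by norm_num) ?_ ?_ ?_
  · refine hlim.congr' ?_
    filter_upwards [hKR.eventually_gt_atTop 0, hcrit] with k hk hcr
    rw [Finset.sum_image (hinj k), mul_assoc, mul_assoc]
    congr 2
    rw [Finset.mul_sum]
    refine Finset.sum_congr rfl fun c hc => ?_
    have h1 : dens k ((√(K k : ℝ))⁻¹ • ((pt k c : fluctSpace T wc) + a k))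
        = (∏ t, √(2 * Real.pi * lam k t) * Real.exp (-lam k t)) * poissonWeight (lam k) c := by
      rw [← prod_poissonDensity_natCast]
      refine Finset.prod_congr rfl fun t _ => ?_
      rw [harg k hk hcr, hpt k c hc, add_sub_cancel]
    have h2 : scaleMap wc (((√(K k : ℝ))⁻¹ • ((pt k c : fluctSpace T wc) + a k) :
        fluctSpace T wc) : EuclideanSpace ℝ T)
        = WithLp.toLp 2 fun t => ((c t : ℝ) - K k * wK k t) / √(K k : ℝ) := by
      refine PiLp.ext fun t => ?_
      have h3 := harg k hk hcr (pt k c) t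
      rw [hpt k c hc] at h3
      have h4 : √(K k : ℝ) ≠ 0 := (Real.sqrt_pos.2 hk).ne'
      rw [scaleMap_apply]
      change _ = ((c t : ℝ) - lam k t) / √(K k : ℝ)
      rw [eq_div_iff h4]
      linarith
    rw [h1, h2]
    ring
  · intro k
    refine Measurable.mul ?_ (hdensm k)
    exact (hH.comp (((scaleMap wc).continuous.comp continuous_subtype_val).add
      continuous_const)).measurable
  · have hs1 : ∀ᶠ k in atTop, ‖s k‖ ≤ 1 := by
      have h1 := hs.norm
      rw [norm_zero] at h1
      exact h1.eventually_le_const one_pos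
    have hl1 : ∀ᶠ k in atTop, ∀ t, 1 ≤ lam k t := by
      refine eventually_all.2 fun t => ?_
      have h1 := hKR.atTop_mul_pos (hwc t) (tendsto_pi_nhds.1 hwK t)
      exact h1.eventually_ge_atTop 1
    have hl2 : ∀ᶠ k in atTop, ∀ t, lam k t ≤ 4 * (K k * wc t) := by
      refine eventually_all.2 fun t => ?_
      have h1 : ∀ᶠ k in atTop, wK k t ≤ 4 * wc t :=
        (tendsto_pi_nhds.1 hwK t).eventually_le_const (by linarith [hwc t])
      filter_upwards [h1] with k hk
      have := mul_le_mul_of_nonneg_left hk (Nat.cast_nonneg (α := ℝ) (K k))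
      rw [hlam]
      linarith
    filter_upwards [hs1, hl1, hl2] with k h1 h2 h3 y
    have h4 := prod_poissonDensity_le (Nat.cast_nonneg (K k)) hwc h2 h3 (y : EuclideanSpace ℝ T)
    have h5 := one_add_norm_sq_le ((scaleMap wc).comp (fluctSpace T wc).subtypeL) h1 y
    have h6 : 0 ≤ dens k y := Finset.prod_nonneg fun t _ =>
      poissonDensity_nonneg (by linarith [h2 t]) _
    rw [abs_mul, abs_of_nonneg h6]
    calc |H (scaleMap wc y + s k)| * dens k y
        ≤ (A * ((2 + 16 * ‖(scaleMap wc).comp (fluctSpace T wc).subtypeL‖) ^ 2 *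
            Real.exp (1 / 8 * ‖y‖))) *
          ((6 * Real.exp 2) ^ Fintype.card T * Real.exp (-(1 / 4 * ‖y‖))) := by
          refine mul_le_mul ((hHA _).trans (mul_le_mul_of_nonneg_left h5 hA0)) h4 h6 ?_
          positivity
      _ = A * (2 + 16 * ‖(scaleMap wc).comp (fluctSpace T wc).subtypeL‖) ^ 2 *
          (6 * Real.exp 2) ^ Fintype.card T *
          (Real.exp (1 / 8 * ‖y‖) * Real.exp (-(1 / 4 * ‖y‖))) := by ring
      _ = _ := by
          rw [← Real.exp_add]
          ring_nf
  · filter_upwards [hKR.eventually_gt_atTop 0, hcrit] with k hk hcr l hl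
    by_contra hne
    have hd : dens k ((√(K k : ℝ))⁻¹ • ((l : fluctSpace T wc) + a k)) ≠ 0 :=
      right_ne_zero_of_mul hne
    choose m hm using (hb _).1 l.2
    -- a density that does not vanish has a nonnegative argument
    have hnn : ∀ t, 0 ≤ (c0 k t : ℤ) + m t := by
      intro t
      by_contra hneg
      refine hd (Finset.prod_eq_zero (Finset.mem_univ t) ?_)
      rw [harg k hk hcr, ← hm, poissonDensity, if_neg]
      exact_mod_cast hneg
    have hcount : (fun t => ((c0 k t : ℤ) + m t).toNat) ∈ countVectors T (N k) := by
      rw [mem_countVectors hT]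
      intro v
      have h1 : (N k v : ℝ) = ∑ t : T, (c0 k t : ℝ) * (t.1.count v : ℝ) := by
        exact_mod_cast hc0 k v
      have h2 := congrFun (mem_fluctSpace.1 (l : fluctSpace T wc).2) v
      rw [incidence_mulVec_apply] at h2
      have h3 : (N k v : ℤ) = ∑ t : T, ((c0 k t : ℤ) + m t) * (t.1.count v : ℤ) := by
        have h4 : (N k v : ℝ) = ∑ t : T, ((c0 k t : ℝ) + m t) * (t.1.count v : ℝ) := by
          simp only [hm, add_mul, Finset.sum_add_distrib]
          rw [h2, ← h1, Pi.zero_apply, add_zero]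
        exact_mod_cast h4
      zify
      rw [h3]
      refine Finset.sum_congr rfl fun t _ => ?_
      rw [Int.toNat_of_nonneg (hnn t)]
    refine hl (Finset.mem_image.2 ⟨_, hcount, ?_⟩)
    refine Subtype.ext (Subtype.ext (PiLp.ext fun t => mul_left_cancel₀ (hsq t) ?_))
    rw [hpt k _ hcount, ← hm]
    have h5 : ((((c0 k t : ℤ) + m t).toNat : ℤ) : ℝ) = ((c0 k t : ℤ) + m t : ℤ) := by
      rw [Int.toNat_of_nonneg (hnn t)]
    push_cast at h5 ⊢
    linarith
  · intro x y hxy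
    refine Tendsto.mul ?_ ?_
    · refine (hH.tendsto _).comp ?_
      have h1 : Tendsto (fun k => scaleMap wc (x k)) atTop (𝓝 (scaleMap wc y)) :=
        (((scaleMap wc).continuous.comp continuous_subtype_val).tendsto y).comp hxy
      simpa using h1.add hs
    · have h1 : Real.exp (-‖y‖ ^ 2 / 2)
          = ∏ t, Real.exp (-((√(wc t) * (y : EuclideanSpace ℝ T) t) ^ 2 / wc t) / 2) := by
        rw [← Real.exp_sum, Submodule.coe_norm, EuclideanSpace.norm_sq_eq, neg_div,
          Finset.sum_div, ← Finset.sum_neg_distrib]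
        congr 1
        refine Finset.sum_congr rfl fun t _ => ?_
        rw [Real.norm_eq_abs, sq_abs, mul_pow, Real.sq_sqrt (hwc t).le,
          mul_div_cancel_left₀ _ (hwc t).ne', neg_div]
      rw [h1]
      refine tendsto_finsetProd _ fun t _ => tendsto_poissonDensity (hwc t) hKR (hlamK t) ?_
      refine (((((hcoord t).tendsto y).comp hxy).const_mul (√(wc t)))).congr' ?_
      filter_upwards [hKR.eventually_gt_atTop 0] with k hk
      have h2 : √(K k : ℝ) ≠ 0 := (Real.sqrt_pos.2 hk).ne'
      rw [add_sub_cancel_left, mul_div_cancel_left₀ _ h2]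
      rfl

end LocalLimit

/-! ### Convergence of moments and the central limit theorem -/

section GaussianLimit

variable {V : Type*} [Fintype V] [DecidableEq V] {T : Finset (Multiset V)}

/-- Expectations of continuous functions of at most quadratic growth converge to Gaussian
expectations. A perturbation `s k` that tends to zero is allowed, so that the centre of the
fluctuations may be moved. -/
theorem tendsto_integral_fluctuation {δ : ℕ} (hδ : 0 < δ)
    (hsize : ∀ t ∈ T, Multiset.card t = δ) {w : T → ℝ} (hw : ∀ t, 0 < w t)
    {N : ℕ → V → ℕ} {K : ℕ → ℕ} (hfeas : ∀ k, IsFeasible T (N k))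
    (hKtop : Tendsto K atTop atTop) {wK : ℕ → T → ℝ} {wc : T → ℝ} (hwc : ∀ t, 0 < wc t)
    (hcrit : ∀ᶠ k in atTop, IsCriticalGauge T w (fun v => (N k v : ℝ) / (K k : ℝ)) (wK k))
    (hwK : Tendsto wK atTop (𝓝 wc))
    {s : ℕ → EuclideanSpace ℝ T} (hs : Tendsto s atTop (𝓝 0))
    {H : EuclideanSpace ℝ T → ℝ} {A : ℝ} (hH : Continuous H)
    (hHA : ∀ z, |H z| ≤ A * (1 + ‖z‖) ^ 2) :
    Tendsto (fun k => ∫ m, H (fluctuation (T := T) (N := N k) (K k) (wK k) m + s k)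
      ∂(tilingMeasure T w (N k))) atTop
      (𝓝 (∫ z, H z ∂(multivariateGaussian 0 (covMatrix T wc)))) := by
  have hT := ne_zero_of_card_eq hδ hsize
  obtain ⟨μ, hμ, hZ, hstd⟩ := exists_haar_integral_stdGaussian (fluctSpace T wc)
  obtain ⟨C, hC⟩ := exists_tendsto_sum_poissonWeight hT hfeas hKtop hwc
    (hcrit.mono fun k hk => hk.2) hwK hs μ
  have h1 := hC H A hH hHA
  have h2 := hC (fun _ => 1) 1 continuous_const fun z => by
    rw [abs_one, one_mul]
    exact one_le_pow₀ (by linarith [norm_nonneg z])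
  simp only [one_mul, mul_one] at h2
  have h3 := h1.div h2 hZ.ne'
  have h4 : ∫ z, H z ∂(multivariateGaussian 0 (covMatrix T wc))
      = (∫ y : fluctSpace T wc, H (scaleMap wc y) * Real.exp (-‖y‖ ^ 2 / 2) ∂μ) /
        ∫ y : fluctSpace T wc, Real.exp (-‖y‖ ^ 2 / 2) ∂μ := by
    rw [← map_stdGaussian_fluctSpace hwc, integral_map
      (ContinuousLinearMap.continuous _).measurable.aemeasurable hH.aestronglyMeasurable]
    exact hstd fun y => H (scaleMap wc y)
  rw [h4]
  refine h3.congr' ?_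
  have hKR : Tendsto (fun k => (K k : ℝ)) atTop atTop := tendsto_natCast_atTop_atTop.comp hKtop
  filter_upwards [hcrit, hKR.eventually_gt_atTop 0, h2.eventually_ne hZ.ne'] with k hk hk0 hne
  obtain ⟨⟨x, hx, hxw⟩, -⟩ := hk
  have h5 := integral_tileCount hδ hsize hw (hfeas k) hx hk0 fun c =>
    H ((WithLp.toLp 2 fun t => ((c t : ℝ) - K k * wK k t) / √(K k : ℝ)) + s k)
  simp only [← hxw] at h5
  rw [Pi.div_apply, mul_div_mul_left _ _ (left_ne_zero_of_mul hne)]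
  exact h5.symm

theorem memLp_eval_multivariateGaussian {ι : Type*} [Fintype ι] [DecidableEq ι]
    (S : Matrix ι ι ℝ) (i : ι) :
    MemLp (fun z : EuclideanSpace ℝ ι => z i) 2 (multivariateGaussian 0 S) :=
  (IsGaussian.memLp_two_id (μ := multivariateGaussian 0 S)).of_le
    (EuclideanSpace.proj (𝕜 := ℝ) i).continuous.aestronglyMeasurable
    (Eventually.of_forall fun z => PiLp.norm_apply_le z i)

theorem integral_eval_multivariateGaussian {ι : Type*} [Fintype ι] [DecidableEq ι]
    (S : Matrix ι ι ℝ) (i : ι) :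
    ∫ z : EuclideanSpace ℝ ι, z i ∂(multivariateGaussian 0 S) = 0 := by
  have h := (EuclideanSpace.proj (𝕜 := ℝ) i).integral_comp_comm
    (IsGaussian.integrable_id (μ := multivariateGaussian 0 S))
  simp only [id, integral_id_multivariateGaussian, map_zero] at h
  exact h

theorem integral_eval_mul_eval_multivariateGaussian {ι : Type*} [Fintype ι] [DecidableEq ι]
    {S : Matrix ι ι ℝ} (hS : S.PosSemidef) (i j : ι) :
    ∫ z : EuclideanSpace ℝ ι, z i * z j ∂(multivariateGaussian 0 S) = S i j := by
  rw [← covariance_eval_multivariateGaussian (μ := 0) hS i j,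
    covariance_eq_sub (memLp_eval_multivariateGaussian S i) (memLp_eval_multivariateGaussian S j),
    integral_eval_multivariateGaussian, zero_mul, sub_zero]
  rfl

section Consequences

variable {δ : ℕ} (hδ : 0 < δ)
  (hsize : ∀ t ∈ T, Multiset.card t = δ) {w : T → ℝ} (hw : ∀ t, 0 < w t)
  {N : ℕ → V → ℕ} {K : ℕ → ℕ} (hfeas : ∀ k, IsFeasible T (N k))
  (hKtop : Tendsto K atTop atTop) {wK : ℕ → T → ℝ} {wc : T → ℝ} (hwc : ∀ t, 0 < wc t)
  (hcrit : ∀ᶠ k in atTop, IsCriticalGauge T w (fun v => (N k v : ℝ) / (K k : ℝ)) (wK k))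
  (hwK : Tendsto wK atTop (𝓝 wc))
  [∀ k, IsProbabilityMeasure (tilingMeasure T w (N k))]

include hδ hsize hw hfeas hKtop hwc hcrit hwK

/-- The mean differs from `K w` by `o(√K)`, because the limiting Gaussian measure is centred. -/
theorem tendsto_mean_fluctuation (t : T) :
    Tendsto (fun k => ((∫ m, (tileCount m t : ℝ) ∂(tilingMeasure T w (N k))) - K k * wK k t) /
      √(K k : ℝ)) atTop (𝓝 0) := by
  have h := tendsto_integral_fluctuation hδ hsize hw hfeas hKtop hwc hcrit hwK
    (s := fun _ => 0) tendsto_const_nhds (H := fun z => z t) (A := 1)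
    (EuclideanSpace.proj (𝕜 := ℝ) t).continuous fun z => by
      have h1 := PiLp.norm_apply_le z t
      rw [Real.norm_eq_abs] at h1
      nlinarith [norm_nonneg z]
  rw [integral_eval_multivariateGaussian] at h
  refine h.congr fun k => ?_
  simp only [add_zero, fluctuation]
  rw [integral_div, integral_sub .of_finite .of_finite, integral_const]
  simp

theorem tendsto_covariance_tileCount (s t : T) :
    Tendsto (fun k => covariance (fun m => (tileCount m s : ℝ)) (fun m => (tileCount m t : ℝ))
      (tilingMeasure T w (N k)) / (K k : ℝ)) atTop (𝓝 (covMatrix T wc s t)) := by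
  have hmean := tendsto_mean_fluctuation hδ hsize hw hfeas hKtop hwc hcrit hwK
  have h := tendsto_integral_fluctuation hδ hsize hw hfeas hKtop hwc hcrit hwK
    (s := fun _ => 0) tendsto_const_nhds (H := fun z => z s * z t) (A := 1)
    ((EuclideanSpace.proj (𝕜 := ℝ) s).continuous.mul
      (EuclideanSpace.proj (𝕜 := ℝ) t).continuous) fun z => by
      have h1 := PiLp.norm_apply_le z s
      have h2 := PiLp.norm_apply_le z t
      have h3 := mul_le_mul h1 h2 (norm_nonneg _) (norm_nonneg _)
      rw [← norm_mul, Real.norm_eq_abs] at h3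
      nlinarith [norm_nonneg z]
  rw [integral_eval_mul_eval_multivariateGaussian (posSemidef_covMatrix hwc)] at h
  have h4 := h.sub ((hmean s).mul (hmean t))
  rw [mul_zero, sub_zero] at h4
  refine h4.congr fun k => ?_
  have hF : ∀ u : T, ((∫ m, (tileCount m u : ℝ) ∂(tilingMeasure T w (N k))) - K k * wK k u) /
      √(K k : ℝ) = ∫ m, ((tileCount m u : ℝ) - K k * wK k u) / √(K k : ℝ)
        ∂(tilingMeasure T w (N k)) := by
    intro u
    rw [integral_div, integral_sub .of_finite .of_finite, integral_const]
    simp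
  have h5 := covariance_eq_sub (μ := tilingMeasure T w (N k))
    (X := fun m => ((tileCount m s : ℝ) - K k * wK k s) / √(K k : ℝ))
    (Y := fun m => ((tileCount m t : ℝ) - K k * wK k t) / √(K k : ℝ)) .of_discrete .of_discrete
  rw [covariance_fun_div_left, covariance_fun_div_right, covariance_sub_const_left .of_finite,
    covariance_sub_const_right .of_finite, div_div, Real.mul_self_sqrt (Nat.cast_nonneg _)] at h5
  rw [h5, hF, hF]
  simp only [add_zero, fluctuation]
  rfl

/-- The central limit theorem, with centres that differ from `K w` by `o(√K)`. -/
theorem tendstoInDistribution_fluctuation {wK' : ℕ → T → ℝ}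
    (hs : ∀ t, Tendsto (fun k => (K k * wK k t - K k * wK' k t) / √(K k : ℝ)) atTop (𝓝 0)) :
    TendstoInDistribution (fun k => fluctuation (T := T) (N := N k) (K k) (wK' k)) atTop
      (id : EuclideanSpace ℝ T → EuclideanSpace ℝ T) (fun k => tilingMeasure T w (N k))
      (multivariateGaussian 0 (covMatrix T wc)) := by
  refine ⟨fun k => Measurable.of_discrete.aemeasurable, aemeasurable_id, ?_⟩
  refine ProbabilityMeasure.tendsto_iff_forall_integral_tendsto.2 fun f => ?_
  let s : ℕ → EuclideanSpace ℝ T := fun k =>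
    WithLp.toLp 2 fun t => (K k * wK k t - K k * wK' k t) / √(K k : ℝ)
  have hs0 : Tendsto s atTop (𝓝 0) :=
    ((PiLp.continuous_toLp 2 (fun _ : T => ℝ)).tendsto 0).comp (tendsto_pi_nhds.2 hs)
  have h := tendsto_integral_fluctuation hδ hsize hw hfeas hKtop hwc hcrit hwK hs0
    (H := f) (A := ‖f‖) f.continuous fun z => by
      have h1 := f.norm_coe_le_norm z
      rw [Real.norm_eq_abs] at h1
      have h2 : (1 : ℝ) ≤ (1 + ‖z‖) ^ 2 := one_le_pow₀ (by linarith [norm_nonneg z])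
      nlinarith [norm_nonneg f]
  refine Tendsto.congr (fun k => ?_) (h.mono_right (le_of_eq ?_))
  swap
  · change _ = 𝓝 (∫ z, f z ∂((multivariateGaussian 0 (covMatrix T wc)).map id))
    rw [Measure.map_id]
  change _ = ∫ z, f z ∂((tilingMeasure T w (N k)).map (fluctuation (K k) (wK' k)))
  rw [integral_map Measurable.of_discrete.aemeasurable f.continuous.aestronglyMeasurable]
  refine integral_congr_ae (Eventually.of_forall fun m => ?_)
  simp only
  congr 1
  refine PiLp.ext fun t => ?_
  simp only [fluctuation, s, PiLp.add_apply]
  ring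

end Consequences

end GaussianLimit

end

end MultinomialTiling

theorem theorem5p1 {V : Type*} [Fintype V] [DecidableEq V]
    (T : Finset (Multiset V)) (δ : ℕ) (hδ : 0 < δ) (hsize : ∀ t ∈ T, Multiset.card t = δ)
    (w : T → ℝ) (hw : ∀ t, 0 < w t)
    (α : V → ℝ) (hα : InFeasibleCone T α)
    (N : ℕ → V → ℕ) (K : ℕ → ℕ)
    (hfeas : ∀ k, IsFeasible T (N k))
    (hK : ∀ k, ∑ v, N k v = δ * K k)
    (hKtop : Tendsto K atTop atTop)
    (hlim : ∀ v, Tendsto (fun k => (N k v : ℝ) / (K k : ℝ)) atTop (𝓝 (α v))) :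
    -- the tilings exist, so that the model is a probability measure
    ∃ _ : ∀ k, IsProbabilityMeasure (tilingMeasure T w (N k)),
    -- the critical-gauge weights `wc` exist and are unique
    ∃ wc : T → ℝ, IsCriticalGauge T w α wc ∧
      (∀ w', IsCriticalGauge T w α w' → w' = wc) ∧
      -- the mean is asymptotic to `K wc`
      (∀ t : T, Tendsto (fun k =>
        (∫ m, (tileCount m t : ℝ)
          ∂(tilingMeasure T w (N k))) / (K k : ℝ)) atTop (𝓝 (wc t))) ∧
      -- the covariance is asymptotic to `K w_s (I - C 𝕂)_{t,s}`
      (∀ s t : T, Tendsto (fun k =>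
        covariance
          (fun m => (tileCount m s : ℝ))
          (fun m => (tileCount m t : ℝ))
          (tilingMeasure T w (N k)) / (K k : ℝ)) atTop
        (𝓝 (wc s * complProjection T wc t s))) ∧
      -- `I - C 𝕂` is the projection with kernel `C Im(D*)` and image `ker D`
      IsIdempotentElem (complProjection T wc) ∧
      LinearMap.ker (complProjection T wc).mulVecLin =
        (LinearMap.range (incidence T).transpose.mulVecLin).map
          (Matrix.diagonal wc).mulVecLin ∧
      LinearMap.range (complProjection T wc).mulVecLin =
        LinearMap.ker (incidence T).mulVecLin ∧
      (covMatrix T wc).PosSemidef ∧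
      -- Gaussian limit, centred at `K` times the critical-gauge weights `wK k` for `N k / K k`
      (∃ wK : ℕ → T → ℝ,
        (∀ᶠ k in atTop,
          IsCriticalGauge T w (fun v => (N k v : ℝ) / (K k : ℝ)) (wK k) ∧
          ∀ w', IsCriticalGauge T w (fun v => (N k v : ℝ) / (K k : ℝ)) w' →
            w' = wK k) ∧
        Tendsto wK atTop (𝓝 wc) ∧
        (∀ t : T, Tendsto (fun k =>
          ((∫ m, (tileCount m t : ℝ)
            ∂(tilingMeasure T w (N k))) - K k * wK k t) / √(K k : ℝ))
          atTop (𝓝 0)) ∧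
        TendstoInDistribution
          (fun k => fluctuation (T := T) (N := N k) (K k) (wK k)) atTop
          (id : EuclideanSpace ℝ T → EuclideanSpace ℝ T)
          (fun k => tilingMeasure T w (N k))
          (multivariateGaussian 0 (covMatrix T wc))) ∧
      -- Gaussian limit, centred at `K wc`, when `N` is close enough to `K α`
      ((∀ v, Tendsto (fun k => ((N k v : ℝ) - K k * α v) / √(K k : ℝ)) atTop (𝓝 0)) →
        (∀ t : T, Tendsto (fun k =>
          ((∫ m, (tileCount m t : ℝ)
            ∂(tilingMeasure T w (N k))) - K k * wc t) / √(K k : ℝ))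
          atTop (𝓝 0)) ∧
        TendstoInDistribution
          (fun k => fluctuation (T := T) (N := N k) (K k) wc) atTop
          (id : EuclideanSpace ℝ T → EuclideanSpace ℝ T)
          (fun k => tilingMeasure T w (N k))
          (multivariateGaussian 0 (covMatrix T wc))) := by
  have hprob : ∀ k, IsProbabilityMeasure (tilingMeasure T w (N k)) := fun k =>
    isProbabilityMeasure_tilingMeasure hw (partitionFunction_pos hδ hsize hw (hfeas k))
  obtain ⟨wc, hcwc⟩ := exists_isCriticalGauge hw hα
  have hwc := hcwc.pos hw
  have hKR : Tendsto (fun k => (K k : ℝ)) atTop atTop := tendsto_natCast_atTop_atTop.comp hKtop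
  have hR : Tendsto (fun k => √(K k : ℝ)) atTop atTop := Real.tendsto_sqrt_atTop.comp hKR
  have hαmem : α ∈ imD T := by
    obtain ⟨c, -, hc⟩ := hα
    exact ⟨c, funext fun v => (incidence_mulVec_apply T c v).trans (hc v).symm⟩
  have hβmem : ∀ k, (fun v => (N k v : ℝ) / (K k : ℝ)) ∈ imD T := by
    intro k
    obtain ⟨c, hc⟩ := hfeas k
    refine ⟨fun t => (c t : ℝ) / K k, funext fun v => ?_⟩
    have h1 : (N k v : ℝ) = ∑ t : T, (c t : ℝ) * (t.1.count v : ℝ) := by exact_mod_cast hc v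
    rw [Matrix.mulVecLin_apply, incidence_mulVec_apply, h1, Finset.sum_div]
    exact Finset.sum_congr rfl fun t _ => by ring
  obtain ⟨Φ, hΦ, hΦO⟩ := exists_local_criticalGauge (α := ⟨α, hαmem⟩) hw hcwc
  let β : ℕ → imD T := fun k => ⟨_, hβmem k⟩
  have hβ : Tendsto β atTop (𝓝 ⟨α, hαmem⟩) := tendsto_subtype_rng.2 (tendsto_pi_nhds.2 hlim)
  set wK : ℕ → T → ℝ := fun k => Φ (β k) with hwKdef
  have hcrit : ∀ᶠ k in atTop,
      IsCriticalGauge T w (fun v => (N k v : ℝ) / (K k : ℝ)) (wK k) := hβ.eventually hΦ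
  have hO : (fun k => wK k - wc) =O[atTop] fun k => β k - ⟨α, hαmem⟩ := hΦO.comp_tendsto hβ
  have hwK : Tendsto wK atTop (𝓝 wc) := by
    have h1 : Tendsto (fun k => β k - ⟨α, hαmem⟩) atTop (𝓝 0) := by
      rw [← sub_self (⟨α, hαmem⟩ : imD T)]
      exact hβ.sub_const _
    exact tendsto_sub_nhds_zero_iff.1 (hO.trans_tendsto h1)
  have hmean := tendsto_mean_fluctuation hδ hsize hw hfeas hKtop hwc hcrit hwK
  refine ⟨hprob, wc, hcwc, fun w' h => h.unique hw hcwc, fun t => ?_, fun s t =>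
    tendsto_covariance_tileCount hδ hsize hw hfeas hKtop hwc hcrit hwK s t,
    isIdempotentElem_complProjection hwc, ker_complProjection hwc, range_complProjection hwc,
    posSemidef_covMatrix hwc,
    ⟨wK, hcrit.mono fun k hk => ⟨hk, fun w' h => h.unique hw hk⟩, hwK, hmean,
      tendstoInDistribution_fluctuation hδ hsize hw hfeas hKtop hwc hcrit hwK fun t => ?_⟩,
    fun hN => ?_⟩
  · have h1 := ((hmean t).mul (tendsto_inv_atTop_zero.comp hR)).add (tendsto_pi_nhds.1 hwK t)
    rw [mul_zero, zero_add] at h1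
    refine h1.congr' ?_
    filter_upwards [hKR.eventually_gt_atTop 0] with k hk
    rw [Function.comp_apply, ← div_eq_mul_inv, div_div, Real.mul_self_sqrt hk.le]
    field_simp
    ring
  · simp
  -- the critical-gauge weights are Lipschitz functions of `N / K`, so that moving `N` by `o(√K)`
  -- moves the centre `K w` by `o(√K)`
  have hshift : ∀ t, Tendsto (fun k => (K k * wK k t - K k * wc t) / √(K k : ℝ)) atTop
      (𝓝 0) := by
    have h1 : Tendsto (fun k => (K k / √(K k : ℝ)) • (β k - ⟨α, hαmem⟩)) atTop (𝓝 0) := by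
      refine tendsto_subtype_rng.2 (tendsto_pi_nhds.2 fun v => (hN v).congr' ?_)
      filter_upwards [hKR.eventually_gt_atTop 0] with k hk
      change _ = (K k / √(K k : ℝ)) * ((N k v : ℝ) / K k - α v)
      field_simp
    have h2 := ((Asymptotics.isBigO_refl (fun k => (K k / √(K k : ℝ))) atTop).smul
      hO).trans_tendsto h1
    intro t
    refine (tendsto_pi_nhds.1 h2 t).congr fun k => ?_
    change (K k / √(K k : ℝ)) * (wK k t - wc t) = _
    ring
  refine ⟨fun t => ?_,
    tendstoInDistribution_fluctuation hδ hsize hw hfeas hKtop hwc hcrit hwK hshift⟩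
  have h1 := (hmean t).add (hshift t)
  rw [add_zero] at h1
  exact h1.congr fun k => by ring
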